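/- **Conventions.** Let $b\in\mathbb R$. All forms on $\mathbb R^3$ below are independent of $z$ and have distributions on the $xy$-plane as coefficients. A product $T\cdot S$ of two distributions means $\lim_{\varepsilon\to0^+}T\,(S*\rho_\varepsilon)$, required to hold for every radial mollifier $\rho$ (smooth, compactly supported, nonnegative, $\int\rho=1$, $\rho_\varepsilon(x)=\varepsilon^{-2}\rho(x/\varepsilon)$); sums of products are regularised together. For a coframe $\vartheta$, a connection $\omega$ has torsion $\tau^i=d\vartheta^i+\omega^i_j\wedge\vartheta^j$ and curvature $\Omega^i_j=d\omega^i_j+\omega^i_k\wedge\omega^k_j$; it is Levi-Civita if $\omega^i_j=-\omega^j_i$, its torsion vanishes, and it is smooth on every open set on which $\vartheta$ is smooth. Dislocations parallel to the $z$-axis with torsion $\tau^2=b\,\mu\,dx\wedge dy$, $\tau^1=\tau^3=0$ ($\mu$ a measure on the plane), i.e. with dislocation density $\alpha^2=b\,\mu\,dz$ and Burgers vectors in the $y$-direction, have by the Biot–Savart law the plastic field $\Theta^2(x)=\frac1{4\pi}\int_{\mathbb R^3}\frac{\alpha^2(\xi)\times(x-\xi)}{\|x-\xi\|^3}$, $\Theta^1=\Theta^3=0$,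 and the coframe $\vartheta=(dx,\,dy+\Theta^2,\,dz)$. **Theorem 3 (Single edge dislocation).** Consider the single edge dislocation $\tau^2=b\,\delta(x,y)\,dx\wedge dy$ with Burgers vector $(0,b,0)$. 1. Off the $z$-axis its plastic field is $\Theta^2=\frac b{2\pi}\left(-\frac{y}{x^2+y^2},\frac{x}{x^2+y^2},0\right)$. It is locally integrable on the plane, and the coframe $\vartheta=(dx,dy+\Theta^2,dz)$ with the zero (Weitzenböck) connection has torsion $\tau^2=b\,\delta(x,y)\,dx\wedge dy$, $\tau^1=\tau^3=0$, and zero curvature. 2. The same coframe has exactly one Levi-Civita connection, and this connection has exactly one curvature. The only nonzero entries of the curvature are $\Omega^1_2=-\Omega^2_1=-b\,\partial_x\delta(x,y)\,dx\wedge dy$. The distribution $\Omega^1_2$ is supported at the origin, has total charge $\int_{\mathbb R^2}\Omega^1_2=0$ and first moment (dipole moment) $P=\int_{\mathbb R^2}\Omega^1_2\,(x,y)=(b,0)$, which is perpendicular to the Burgers vector $(0,b)$. 3. The plastic field is that of a wedge disclination dipole at infinitesimal separation. For $L^\pm>0$ let $\Theta^2_{L^-,L^+}$ be the Biot–Savart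 field of the torsion $\tau^2=\frac{b}{L^-+L^+}\,\delta(y)\,\big(H(x+L^-)-H(x-L^+)\big)\,dx\wedge dy$. It is locally integrable, and its coframe has this torsion for the zero connection. This coframe also has a Levi-Civita connection with curvature $\Omega^1_2=-\Omega^2_1=\frac{b}{L^-+L^+}\big(\delta_{(L^+,0)}-\delta_{(-L^-,0)}\big)\,dx\wedge dy$, all other entries zero; that is, it is the coframe of two wedge disclinations of opposite Frank angles of magnitude $|b|/(L^-+L^+)$, with dipole moment $(b,0)$. As $L^\pm\to0^+$, $\Theta^2_{L^-,L^+}\to\Theta^2$ pointwise off the $z$-axis, and these curvatures $\Omega^1_2$ converge in the sense of distributions to the curvature $-b\,\partial_x\delta(x,y)\,dx\wedge dy$ of the single edge dislocation. -/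

import Mathlib

open MeasureTheory Filter Topology Distributions LineDeriv


namespace Volterra

noncomputable section

/-! ### Distributions on the plane orthogonal to the defect line -/

/-- The `xy`-plane. -/
abbrev Plane := EuclideanSpace ℝ (Fin 2)

/-- Real test functions on the plane. -/
abbrev Test := 𝓓((⊤ : TopologicalSpace.Opens Plane), ℝ)

/-- Real distributions on the plane. -/
abbrev Dist := 𝓓'((⊤ : TopologicalSpace.Opens Plane), ℝ)

open Classical in
/-- A smooth compactly supported function as a test function. The value on other functions is
irrelevant: below it is only used where `f` is smooth with compact support. -/
def toTest (f : Plane → ℝ) : Test :=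
  if h : ContDiff ℝ (⊤ : ℕ∞) f ∧ HasCompactSupport f then
    ⟨f, h.1, h.2, fun _ _ => trivial⟩
  else 0

/-- The regular distribution `φ ↦ ∫ f φ` of a locally integrable function. -/
def ofFun (f : Plane → ℝ) : Dist :=
  (TestFunction.integralAgainstBilinCLM (ContinuousLinearMap.mul ℝ ℝ) volume f : Test →L[ℝ] ℝ)

/-- The distribution `φ ↦ ∫ φ dμ` of a locally finite measure. -/
def ofMeasure (μ : Measure Plane) : Dist :=
  (TestFunction.integralAgainstBilinCLM (ContinuousLinearMap.mul ℝ ℝ) μ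
    (fun _ => (1 : ℝ)) : Test →L[ℝ] ℝ)

/-- `T` is given on the open set `U` by a smooth function. -/
def SmoothOn (T : Dist) (U : Set Plane) : Prop :=
  ∃ f : Plane → ℝ, ContDiffOn ℝ (⊤ : ℕ∞) f U ∧
    ∀ φ : Test, tsupport φ ⊆ U → T φ = ∫ x, f x * φ x

/-- `T` has compact support and its pairing with the smooth function `f` (that is, `∫ T f`)
is `c`: on every test function that coincides with `f` near the support, `T` takes the value
`c`. -/
def HasPairing (T : Dist) (f : Plane → ℝ) (c : ℝ) : Prop :=
  ∃ K : Set Plane, IsCompact K ∧ (∀ φ : Test, Disjoint (tsupport φ) K → T φ = 0) ∧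
    ∀ φ : Test, (∀ᶠ x in 𝓝ˢ K, φ x = f x) → T φ = c

/-- Radial (rotationally symmetric) mollifiers. -/
structure IsRadialMollifier (ρ : Test) : Prop where
  nonneg : ∀ x, 0 ≤ ρ x
  radial : ∀ x y : Plane, ‖x‖ = ‖y‖ → ρ x = ρ y
  integral_eq_one : ∫ x, ρ x = 1

/-- The mollification `(S * ρ_ε)(x) = S (y ↦ ε⁻² ρ ((x - y) / ε))`, a smooth function for
every `ε > 0`. -/
def mollify (ρ : Test) (ε : ℝ) (S : Dist) (x : Plane) : ℝ :=
  S (toTest fun y => (ε ^ 2)⁻¹ * ρ (ε⁻¹ • (x - y)))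

/-- The regularised product `⟨T · (S * ρ_ε), φ⟩`. The product `T · S` of two distributions is
understood as the limit of this for `ε → 0`, for every radial mollifier `ρ`. -/
def regMul (ρ : Test) (ε : ℝ) (T S : Dist) (φ : Test) : ℝ :=
  T (toTest fun x => mollify ρ ε S x * φ x)

/-! ### Differential forms on `ℝ³` that do not depend on `z`

The index `0, 1, 2` stands for `x, y, z`. Coefficients are distributions in `(x, y)`. -/

/-- `α = ∑ k, α k dxᵏ`. -/
abbrev OneForm := Fin 3 → Dist

/-- `σ = ½ ∑ k l, σ k l dxᵏ ∧ dxˡ`, so `σ 0 1` is the coefficient of `dx ∧ dy`. -/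
abbrev TwoForm := Fin 3 → Fin 3 → Dist

/-- Partial derivatives of a distribution that does not depend on `z`. -/
def pderiv (k : Fin 3) (T : Dist) : Dist :=
  ![∂_{(EuclideanSpace.single 0 1 : Plane)} T, ∂_{(EuclideanSpace.single 1 1 : Plane)} T, 0] k

/-- The exterior derivative of a `1`-form. -/
def extDeriv (α : OneForm) : TwoForm :=
  fun k l => pderiv k (α l) - pderiv l (α k)

/-- The `dxᵏ ∧ dxˡ` coefficient of the regularised wedge product `α ∧ (β * ρ_ε)`, paired
with `φ`. -/
def regWedge (ρ : Test) (ε : ℝ) (α β : OneForm) (k l : Fin 3) (φ : Test) : ℝ :=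
  regMul ρ ε (α k) (β l) φ - regMul ρ ε (α l) (β k) φ

/-- The `2`-form `T dx ∧ dy`. -/
def dxdy (T : Dist) : TwoForm :=
  fun k l => if k = 0 ∧ l = 1 then T else if k = 1 ∧ l = 0 then -T else 0

/-! ### Cartan's structure equations -/

/-- A moving coframe: `ϑ i` is the `i`-th `1`-form. -/
abbrev Coframe := Fin 3 → OneForm

/-- Connection `1`-forms `ω i j = ωⁱⱼ`. -/
abbrev Connection := Fin 3 → Fin 3 → OneForm

/-- Families of vector-valued and of matrix-valued `2`-forms. -/
abbrev Torsion := Fin 3 → TwoForm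

abbrev Curvature := Fin 3 → Fin 3 → TwoForm

/-- First structure equation `τⁱ = dϑⁱ + ωⁱⱼ ∧ ϑʲ`. -/
def IsTorsion (ϑ : Coframe) (ω : Connection) (τ : Torsion) : Prop :=
  ∀ ρ : Test, IsRadialMollifier ρ → ∀ (i k l : Fin 3) (φ : Test),
    Tendsto (fun ε : ℝ => extDeriv (ϑ i) k l φ + ∑ j, regWedge ρ ε (ω i j) (ϑ j) k l φ)
      (𝓝[>] 0) (𝓝 (τ i k l φ))

/-- Second structure equation `Ωⁱⱼ = dωⁱⱼ + ωⁱₘ ∧ ωᵐⱼ`. -/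
def IsCurvature (ω : Connection) (Ω : Curvature) : Prop :=
  ∀ ρ : Test, IsRadialMollifier ρ → ∀ (i j k l : Fin 3) (φ : Test),
    Tendsto (fun ε : ℝ => extDeriv (ω i j) k l φ + ∑ m, regWedge ρ ε (ω i m) (ω m j) k l φ)
      (𝓝[>] 0) (𝓝 (Ω i j k l φ))

/-- `ω` is a Levi-Civita connection form of the metric for which `ϑ` is orthonormal: it is
metric, torsion free, and an ordinary smooth form wherever the coframe is smooth. -/
structure IsLeviCivita (ϑ : Coframe) (ω : Connection) : Prop where
  skew : ∀ i j k, ω i j k = -ω j i k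
  torsion_free : IsTorsion ϑ ω 0
  smooth : ∀ U : Set Plane, IsOpen U → (∀ i k, SmoothOn (ϑ i k) U) →
    ∀ i j k, SmoothOn (ω i j k) U

/-- The skew matrix of `2`-forms whose only nonzero entries are `Ω¹₂ = -Ω²₁ = T dx ∧ dy`
(rotations about the `z`-axis: wedge disclinations). -/
def wedgeCurvature (T : Dist) : Curvature :=
  fun i j => if i = 0 ∧ j = 1 then dxdy T else if i = 1 ∧ j = 0 then dxdy (-T) else 0

/-- The torsion `τ² = T dx ∧ dy`, `τ¹ = τ³ = 0` of edge dislocations along the `z`-axis with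
Burgers vectors in the `y`-direction. -/
def edgeTorsion (T : Dist) : Torsion :=
  fun i => if i = 1 then dxdy T else 0

/-- The Riemannian geometry of `ϑ` is that of a wedge disclination dipole: a wedge disclination
at `p` and one of opposite Frank angle at `q`, of magnitude `|Φ|`. -/
def IsWedgeDipole (ϑ : Coframe) (Φ : ℝ) (p q : Plane) : Prop :=
  ∃ (ω : Connection) (Ω : Curvature), IsLeviCivita ϑ ω ∧ IsCurvature ω Ω ∧
    Ω = wedgeCurvature (Φ • (Distribution.delta p - Distribution.delta q))

/-! ### The Biot--Savart law -/

/-- Biot--Savart law for straight dislocation lines parallel to the `z`-axis with density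
`b μ` in the plane, that is `α = b μ ⊗ dz`:
`Θ(p) = (1 / 4π) ∫ α(ξ) × (p - ξ) / ‖p - ξ‖³`. -/
def biotSavart (b : ℝ) (μ : Measure Plane) (p : EuclideanSpace ℝ (Fin 3)) : Fin 3 → ℝ :=
  (1 / (4 * Real.pi)) • ∫ ξ : Plane × ℝ,
    (‖p - !₂[ξ.1 0, ξ.1 1, ξ.2]‖ ^ 3)⁻¹ •
      crossProduct ![0, 0, b] (p - !₂[ξ.1 0, ξ.1 1, ξ.2]).ofLp ∂(μ.prod volume)

/-- The Biot--Savart field of straight lines parallel to the `z`-axis does not depend on `z`. -/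
theorem biotSavart_add_z (b : ℝ) (μ : Measure Plane) [SFinite μ] (x y z : ℝ) :
    biotSavart b μ !₂[x, y, z] = biotSavart b μ !₂[x, y, 0] := by
  unfold biotSavart
  congr 1
  have h : MeasurePreserving (fun ξ : Plane × ℝ => (ξ.1, ξ.2 + z))
      (μ.prod volume) (μ.prod volume) :=
    (MeasurePreserving.id μ).prod (measurePreserving_add_right volume z)
  have he : MeasurableEmbedding (fun ξ : Plane × ℝ => (ξ.1, ξ.2 + z)) :=
    ((MeasurableEquiv.refl Plane).prodCongr (MeasurableEquiv.addRight z)).measurableEmbedding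
  rw [← h.integral_comp he]
  congr 1
  funext ξ
  have e : (!₂[x, y, z] : EuclideanSpace ℝ (Fin 3)) - !₂[ξ.1 0, ξ.1 1, ξ.2 + z] =
      !₂[x, y, 0] - !₂[ξ.1 0, ξ.1 1, ξ.2] := by
    ext i
    fin_cases i <;> simp
  simp only [e]

/-- The plastic displacement gradient `Θ²` as a field on the plane `z = 0`. -/
def plasticField (b : ℝ) (μ : Measure Plane) (k : Fin 3) (x : Plane) : ℝ :=
  biotSavart b μ !₂[x 0, x 1, 0] k

/-- The coframe `ϑ = (dx, dy + Θ², dz)`. -/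
def coframe (b : ℝ) (μ : Measure Plane) : Coframe :=
  fun i k => (if i = k then ofFun (fun _ => 1) else 0) +
    (if i = 1 then ofFun (plasticField b μ k) else 0)

/-- Uniform distribution of total mass one on the segment `-L⁻ < x < L⁺`, `y = 0`. -/
def arrayMeasure (Lm Lp : ℝ) : Measure Plane :=
  ENNReal.ofReal (1 / (Lm + Lp)) •
    (volume.restrict (Set.Ioo (-Lm) Lp)).map (fun s : ℝ => (!₂[s, 0] : Plane))

end

end Volterra

open Volterra

namespace Volterra

noncomputable section

/-! ### Test functions and regular distributions -/

/-! Write `ϑ² = p dx + q dy`, with `p = Θ²ₓ` and `q = 1 + Θ²_y`. Integrating the Biot–Savart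
integrand along each line turns `Θ²` into the convolution of `b μ` with a plane kernel whose
components are the imaginary and real parts of `1/(2πw)`, `w = x + iy` (`biotSavart_eq_potential`).
This kernel has curl `δ` (`integral_kernel_curl`), so the potential of `μ` has curl `μ`
(`curl_potential`), which gives the torsion of the Weitzenböck connection.

Existence of a Levi-Civita connection (`isLeviCivita_edgeConnection`): for `μ` carried by the
`x`-axis take `ω¹₂ = -ω²₁ = -b μ dy`. Then `ω²₁ ∧ dx` cancels `dϑ²`. In the equation for `τ¹` the
only remaining term is the product of `b μ` with `p`. It is zero already before the limit: `p` is
odd in `y`, so its radial mollification vanishes on the axis (`mollify_potential_eq_zero`). The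
quadratic part of the curvature drops out because `ω` has only `dy` components, leaving `-b ∂ₓμ dx ∧
dy`. For the uniform segment this is a difference of two deltas at the endpoints
(`neg_pderiv_arrayMeasure`).

Uniqueness for the single dislocation (`IsLeviCivita.eq_edgeConnection`): it suffices to test with
one mollifier supported in an annulus. The mean of `1/w` over a circle is zero if the circle
encloses the pole, and the value at the centre if the pole lies outside. Hence the mollified kernel
is exactly zero for `‖x‖ < ε` and exactly the kernel for `‖x‖ > 2ε` (`mollify_kernel_of_norm_lt`,
`mollify_kernel_of_lt_norm`). Regularised products therefore become exact for small `ε`: away from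
the origin they are multiplication by `p` and `q`, and on distributions carried by the origin
multiplication by `0` and `1`. The torsion equations are solved twice. The first pass shows that `ω`
vanishes off the origin, the second determines `ω` on all test functions. -/

theorem toTest_apply {f : Plane → ℝ} (h : ContDiff ℝ (⊤ : ℕ∞) f) (hc : HasCompactSupport f)
    (x : Plane) : toTest f x = f x := by
  rw [toTest, dif_pos ⟨h, hc⟩]
  rfl

@[simp]
theorem toTest_coe (φ : Test) : toTest φ = φ := by
  ext x
  exact toTest_apply φ.contDiff φ.hasCompactSupport x

@[simp]
theorem toTest_zero : toTest (fun _ => 0) = 0 := by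
  ext x
  exact toTest_apply contDiff_const HasCompactSupport.zero x

theorem ofFun_apply {f : Plane → ℝ} (hf : LocallyIntegrable f) (φ : Test) :
    ofFun f φ = ∫ x, f x * φ x := by
  have h := TestFunction.integralAgainstBilinCLM_eq_integral
    (B := ContinuousLinearMap.mul ℝ ℝ) (hf.locallyIntegrableOn _) (f := φ)
  refine h.trans ?_
  simp [mul_comm]

theorem ofMeasure_apply (μ : Measure Plane) [IsLocallyFiniteMeasure μ] (φ : Test) :
    ofMeasure μ φ = ∫ x, φ x ∂μ := by
  have h := TestFunction.integralAgainstBilinCLM_eq_integral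
    (B := ContinuousLinearMap.mul ℝ ℝ) (Ω := ⊤) (φ := fun _ => (1 : ℝ)) (μ := μ)
    ((locallyIntegrable_const 1).locallyIntegrableOn _) (f := φ)
  refine h.trans ?_
  simp

theorem Test.integrable_mul (φ : Test) {f : Plane → ℝ} (hf : LocallyIntegrable f) :
    Integrable fun x => f x * φ x := by
  simpa [mul_comm] using TestFunction.integrable_bilin (ContinuousLinearMap.mul ℝ ℝ)
    (hf.locallyIntegrableOn _) φ

theorem Test.lineDeriv_apply (φ : Test) (v x : Plane) : (∂_{v} φ) x = fderiv ℝ φ x v := by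
  rw [TestFunction.lineDerivOp_eq_lineDerivCLM ℝ]
  rfl

/-! ### Mollification -/

/-- The rescaled mollifier `ρ_ε`. -/
def rescale (ρ : Test) (ε : ℝ) (x : Plane) : ℝ := (ε ^ 2)⁻¹ * ρ (ε⁻¹ • x)

theorem contDiff_rescale (ρ : Test) (ε : ℝ) : ContDiff ℝ (⊤ : ℕ∞) (rescale ρ ε) :=
  contDiff_const.mul (ρ.contDiff.comp (contDiff_const_smul _))

theorem hasCompactSupport_rescale (ρ : Test) {ε : ℝ} (hε : 0 < ε) :
    HasCompactSupport (rescale ρ ε) :=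
  (ρ.hasCompactSupport.comp_homeomorph (Homeomorph.smulOfNeZero ε⁻¹ (inv_ne_zero hε.ne'))).mul_left

theorem integral_rescale (ρ : Test) {ε : ℝ} (hε : 0 < ε) : ∫ x, rescale ρ ε x = ∫ x, ρ x := by
  unfold rescale
  rw [integral_const_mul, Measure.integral_comp_inv_smul]
  simp [abs_of_pos (pow_pos hε 2), pow_ne_zero 2 hε.ne']

theorem IsRadialMollifier.rescale_radial {ρ : Test} (h : IsRadialMollifier ρ) (ε : ℝ) {x y : Plane}
    (hxy : ‖x‖ = ‖y‖) : rescale ρ ε x = rescale ρ ε y := by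
  unfold rescale
  rw [h.radial (ε⁻¹ • x) (ε⁻¹ • y) (by simp [norm_smul, hxy])]

theorem mollify_eq (ρ : Test) (ε : ℝ) (S : Dist) (x : Plane) :
    mollify ρ ε S x = S (toTest fun y => rescale ρ ε (x - y)) := rfl

theorem hasCompactSupport_rescale_sub (ρ : Test) {ε : ℝ} (hε : 0 < ε) (x : Plane) :
    HasCompactSupport fun y => rescale ρ ε (x - y) :=
  (hasCompactSupport_rescale ρ hε).comp_homeomorph (Homeomorph.subLeft x)

theorem contDiff_rescale_sub (ρ : Test) (ε : ℝ) (x : Plane) :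
    ContDiff ℝ (⊤ : ℕ∞) fun y => rescale ρ ε (x - y) :=
  (contDiff_rescale ρ ε).comp (contDiff_const.sub contDiff_id)

theorem mollify_ofFun (ρ : Test) {ε : ℝ} (hε : 0 < ε) {f : Plane → ℝ} (hf : LocallyIntegrable f)
    (x : Plane) : mollify ρ ε (ofFun f) x = ∫ y, f y * rescale ρ ε (x - y) := by
  rw [mollify_eq ρ ε, ofFun_apply hf]
  congr 1
  funext y
  rw [toTest_apply (contDiff_rescale_sub ρ ε x) (hasCompactSupport_rescale_sub ρ hε x)]

theorem mollify_ofFun_sub (ρ : Test) {ε : ℝ} (hε : 0 < ε) {f : Plane → ℝ}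
    (hf : LocallyIntegrable f) (x : Plane) :
    mollify ρ ε (ofFun f) x = ∫ y, f (x - y) * rescale ρ ε y := by
  rw [mollify_ofFun ρ hε hf, ← integral_sub_left_eq_self _ volume x]
  simp

theorem contDiff_mollify_ofFun (ρ : Test) {ε : ℝ} (hε : 0 < ε) {f : Plane → ℝ}
    (hf : LocallyIntegrable f) : ContDiff ℝ (⊤ : ℕ∞) (mollify ρ ε (ofFun f)) := by
  have := (hasCompactSupport_rescale ρ hε).contDiff_convolution_right
    (ContinuousLinearMap.mul ℝ ℝ) hf (contDiff_rescale ρ ε)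
  convert this using 1
  funext x
  rw [mollify_ofFun ρ hε hf]
  rfl

theorem mollify_add (ρ : Test) (ε : ℝ) (S T : Dist) (x : Plane) :
    mollify ρ ε (S + T) x = mollify ρ ε S x + mollify ρ ε T x := rfl

@[simp]
theorem mollify_zero (ρ : Test) (ε : ℝ) (x : Plane) : mollify ρ ε 0 x = 0 := rfl

theorem mollify_one {ρ : Test} (h : IsRadialMollifier ρ) {ε : ℝ} (hε : 0 < ε) (x : Plane) :
    mollify ρ ε (ofFun fun _ => 1) x = 1 := by
  rw [mollify_ofFun_sub ρ hε (locallyIntegrable_const 1)]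
  simp [integral_rescale ρ hε, h.integral_eq_one]

@[simp]
theorem ofFun_zero : ofFun (fun _ => 0) = 0 := by
  ext φ
  rw [ofFun_apply (locallyIntegrable_const 0)]
  simp

@[simp]
theorem regMul_zero_left (ρ : Test) (ε : ℝ) (S : Dist) (φ : Test) : regMul ρ ε 0 S φ = 0 := rfl

@[simp]
theorem regMul_zero_right (ρ : Test) (ε : ℝ) (T : Dist) (φ : Test) : regMul ρ ε T 0 φ = 0 := by
  simp [regMul]

theorem regMul_neg_left (ρ : Test) (ε : ℝ) (T S : Dist) (φ : Test) :
    regMul ρ ε (-T) S φ = -regMul ρ ε T S φ := rfl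

theorem regMul_one {ρ : Test} (h : IsRadialMollifier ρ) {ε : ℝ} (hε : 0 < ε) (T : Dist)
    (φ : Test) : regMul ρ ε T (ofFun fun _ => 1) φ = T φ := by
  unfold regMul
  simp only [mollify_one h hε, one_mul]
  congr 1
  exact toTest_coe φ

/-- A distribution carried by a measure does not see a regularised factor vanishing almost
everywhere for the measure. -/
theorem regMul_ofMeasure_eq_zero {μ : Measure Plane} [IsLocallyFiniteMeasure μ] {ρ : Test} {ε : ℝ}
    {S : Dist} (h : ∀ᵐ x ∂μ, mollify ρ ε S x = 0) (φ : Test) :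
    regMul ρ ε (ofMeasure μ) S φ = 0 := by
  unfold regMul
  rw [ofMeasure_apply]
  apply integral_eq_zero_of_ae
  filter_upwards [h] with x hx
  -- If the product is not smooth, `toTest` returns its default value `0`, so both branches vanish
  -- and no smoothness of the mollification is needed.
  unfold toTest
  split_ifs with hc
  · change mollify ρ ε S x * φ x = 0
    rw [hx, zero_mul]
  · rfl

/-! ### The complex coordinate and the kernel of the plane Biot--Savart law -/

/-- The complex coordinate `x + i y` on the plane. -/
def toComplex : Plane ≃ₗᵢ[ℝ] ℂ := Complex.orthonormalBasisOneI.repr.symm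

theorem toComplex_apply (x : Plane) : toComplex x = x 0 + x 1 * Complex.I :=
  Complex.orthonormalBasisOneI_repr_symm_apply x

@[simp]
theorem toComplex_re (x : Plane) : (toComplex x).re = x 0 := by simp [toComplex_apply]

@[simp]
theorem toComplex_im (x : Plane) : (toComplex x).im = x 1 := by simp [toComplex_apply]

/-- The plastic field of a straight dislocation with unit Burgers vector. -/
def kernel (k : Fin 3) (x : Plane) : ℝ :=
  (2 * Real.pi)⁻¹ * ![(toComplex x)⁻¹.im, (toComplex x)⁻¹.re, 0] k

theorem kernel_zero_apply (x : Plane) :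
    kernel 0 x = -(2 * Real.pi)⁻¹ * (x 1 / (x 0 ^ 2 + x 1 ^ 2)) := by
  simp [kernel, Complex.inv_im, Complex.normSq_apply]
  ring

theorem kernel_one_apply (x : Plane) :
    kernel 1 x = (2 * Real.pi)⁻¹ * (x 0 / (x 0 ^ 2 + x 1 ^ 2)) := by
  simp [kernel, Complex.inv_re, Complex.normSq_apply]
  ring

@[simp]
theorem kernel_two : kernel 2 = 0 := by
  funext x
  simp [kernel]

theorem abs_kernel_le (k : Fin 3) (x : Plane) : |kernel k x| ≤ (2 * Real.pi)⁻¹ * ‖x‖⁻¹ := by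
  have hn : ‖(toComplex x)⁻¹‖ = ‖x‖⁻¹ := by rw [norm_inv, LinearIsometryEquiv.norm_map]
  unfold kernel
  rw [abs_mul, abs_of_pos (by positivity), ← hn]
  gcongr
  fin_cases k
  · exact Complex.abs_im_le_norm _
  · exact Complex.abs_re_le_norm _
  · simp

theorem measurable_kernel (k : Fin 3) : Measurable (kernel k) := by
  have h : Measurable fun x : Plane => (toComplex x)⁻¹ := toComplex.continuous.measurable.inv
  fin_cases k
  · exact (Complex.measurable_im.comp h).const_mul _
  · exact (Complex.measurable_re.comp h).const_mul _
  · change Measurable (kernel 2)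
    rw [kernel_two]
    exact measurable_zero

/-- The bound `‖x‖⁻¹` is locally integrable because the exponent `1` is below the dimension `2`. -/
theorem locallyIntegrable_kernel (k : Fin 3) : LocallyIntegrable (kernel k) := by
  refine locallyIntegrable_of_norm_le_rpow (C := (2 * Real.pi)⁻¹) (α := 1) (by simp) (by simp)
    (.of_forall fun x => ?_) (measurable_kernel k).aestronglyMeasurable
  rw [Real.rpow_neg_one]
  exact abs_kernel_le k x

theorem contDiffAt_kernel (k : Fin 3) {x : Plane} (hx : x ≠ 0) :
    ContDiffAt ℝ (⊤ : ℕ∞) (kernel k) x := by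
  have h : ContDiffAt ℝ (⊤ : ℕ∞) (fun x : Plane => (toComplex x)⁻¹) x :=
    toComplex.contDiff.contDiffAt.inv (by simpa using hx)
  fin_cases k
  · exact contDiffAt_const.mul (Complex.imCLM.contDiff.contDiffAt.comp x h)
  · exact contDiffAt_const.mul (Complex.reCLM.contDiff.contDiffAt.comp x h)
  · change ContDiffAt ℝ (⊤ : ℕ∞) (kernel 2) x
    rw [kernel_two]
    exact contDiffAt_const

/-! ### Polar coordinates -/

/-- The unit vector at angle `θ`. -/
def unitVec (θ : ℝ) : Plane := toComplex.symm (Real.cos θ + Real.sin θ * Complex.I)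

theorem toComplex_smul_unitVec (r θ : ℝ) :
    toComplex (r • unitVec θ) = r * (Real.cos θ + Real.sin θ * Complex.I) := by
  simp [unitVec, mul_add]

theorem toComplex_smul_unitVec_eq_circleMap (r θ : ℝ) :
    toComplex (r • unitVec θ) = circleMap 0 r θ := by
  rw [toComplex_smul_unitVec, circleMap, Complex.exp_mul_I]
  simp

theorem norm_unitVec (θ : ℝ) : ‖unitVec θ‖ = 1 := by
  rw [← one_smul ℝ (unitVec θ), ← toComplex.norm_map, toComplex_smul_unitVec_eq_circleMap]
  simp

theorem continuous_unitVec : Continuous unitVec := by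
  unfold unitVec
  fun_prop

theorem integral_eq_polar {E : Type*} [NormedAddCommGroup E] [NormedSpace ℝ E] (f : Plane → E) :
    ∫ x, f x =
      ∫ p in Set.Ioi (0 : ℝ) ×ˢ Set.Ioo (-Real.pi) Real.pi, p.1 • f (p.1 • unitVec p.2) := by
  have h := toComplex.symm.measurePreserving.integral_comp
    toComplex.symm.toHomeomorph.measurableEmbedding f
  rw [← h, ← Complex.integral_comp_polarCoord_symm]
  congr 1
  funext p
  congr 2
  rw [LinearIsometryEquiv.symm_apply_eq, toComplex_smul_unitVec, Complex.polarCoord_symm_apply]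

theorem integrableOn_polar {E : Type*} [NormedAddCommGroup E] {G : ℝ × ℝ → E} (hG : Continuous G)
    {R : ℝ} (hR : ∀ r θ, R < r → G (r, θ) = 0) :
    IntegrableOn G (Set.Ioi (0 : ℝ) ×ˢ Set.Ioo (-Real.pi) Real.pi) := by
  have h : IntegrableOn G (Set.Icc 0 R ×ˢ Set.Icc (-Real.pi) Real.pi) :=
    hG.continuousOn.integrableOn_compact (isCompact_Icc.prod isCompact_Icc)
  refine h.of_forall_sdiff_eq_zero (measurableSet_Ioi.prod measurableSet_Ioo) ?_
  rintro ⟨r, θ⟩ ⟨⟨hr, hθ⟩, hn⟩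
  refine hR r θ ?_
  by_contra hle
  exact hn ⟨⟨(Set.mem_Ioi.1 hr).le, not_lt.1 hle⟩, hθ.1.le, hθ.2.le⟩

theorem setIntegral_polar_angle_first {E : Type*} [NormedAddCommGroup E] [NormedSpace ℝ E]
    {G : ℝ × ℝ → E} (hG : Continuous G) {R : ℝ} (hR : ∀ r θ, R < r → G (r, θ) = 0) :
    ∫ p in Set.Ioi (0 : ℝ) ×ˢ Set.Ioo (-Real.pi) Real.pi, G p =
      ∫ r in Set.Ioi (0 : ℝ), ∫ θ in Set.Ioo (-Real.pi) Real.pi, G (r, θ) :=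
  setIntegral_prod _ (integrableOn_polar hG hR)

theorem setIntegral_polar_radius_first {E : Type*} [NormedAddCommGroup E] [NormedSpace ℝ E]
    {G : ℝ × ℝ → E} (hG : Continuous G) {R : ℝ} (hR : ∀ r θ, R < r → G (r, θ) = 0) :
    ∫ p in Set.Ioi (0 : ℝ) ×ˢ Set.Ioo (-Real.pi) Real.pi, G p =
      ∫ θ in Set.Ioo (-Real.pi) Real.pi, ∫ r in Set.Ioi (0 : ℝ), G (r, θ) := by
  have h := integrableOn_polar hG hR
  rw [IntegrableOn, Measure.volume_eq_prod, ← Measure.prod_restrict] at h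
  rw [Measure.volume_eq_prod, ← Measure.prod_restrict]
  exact integral_prod_symm _ h

/-! ### The kernel is a fundamental solution of the exterior derivative -/

theorem norm_smul_unitVec {r : ℝ} (hr : 0 ≤ r) (θ : ℝ) : ‖r • unitVec θ‖ = r := by
  rw [norm_smul, norm_unitVec, mul_one, Real.norm_of_nonneg hr]

theorem Test.exists_radius (φ : Test) : ∃ R : ℝ, 0 < R ∧ ∀ x, R < ‖x‖ → x ∉ tsupport φ := by
  obtain ⟨R, hR, h⟩ := φ.hasCompactSupport.isBounded.exists_pos_norm_lt
  exact ⟨R, hR, fun x hx hm => absurd (h x hm) (not_lt.2 hx.le)⟩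

theorem continuous_fderiv (φ : Test) : Continuous (fderiv ℝ φ) :=
  φ.contDiff.continuous_fderiv (by simp)

/-- The kernel is the angular field of size `1/(2πr)`. The weak curl pairs it with a gradient turned
by a right angle, so only the radial derivative of `φ` survives. -/
theorem kernel_pairing_fderiv (φ : Test) (x : Plane) :
    kernel 0 x * (∂_{(EuclideanSpace.single 1 1 : Plane)} φ) x -
      kernel 1 x * (∂_{(EuclideanSpace.single 0 1 : Plane)} φ) x =
      -(2 * Real.pi)⁻¹ * ((‖x‖ ^ 2)⁻¹ * fderiv ℝ φ x x) := by
  have hx : x = x 0 • (EuclideanSpace.single 0 1 : Plane) + x 1 • EuclideanSpace.single 1 1 := by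
    ext i
    fin_cases i <;> simp
  rw [Test.lineDeriv_apply, Test.lineDeriv_apply, kernel_zero_apply, kernel_one_apply,
    EuclideanSpace.real_norm_sq_eq, Fin.sum_univ_two]
  conv_rhs => rw [show fderiv ℝ φ x x = fderiv ℝ φ x (x 0 • (EuclideanSpace.single 0 1 : Plane) +
    x 1 • EuclideanSpace.single 1 1) by rw [← hx]]
  rw [map_add, map_smul, map_smul, smul_eq_mul, smul_eq_mul]
  ring

theorem integral_radial_derivative (φ : Test) (θ : ℝ) :
    ∫ r in Set.Ioi (0 : ℝ), fderiv ℝ φ (r • unitVec θ) (unitVec θ) = -φ 0 := by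
  obtain ⟨R, hR, h⟩ := φ.exists_radius
  have hd : ∀ r : ℝ, HasDerivAt (fun r : ℝ => φ (r • unitVec θ))
      (fderiv ℝ φ (r • unitVec θ) (unitVec θ)) r := fun r => by
    have h1 : HasFDerivAt φ (fderiv ℝ φ (r • unitVec θ)) (r • unitVec θ) :=
      ((φ.contDiff.differentiable (by simp)) _).hasFDerivAt
    have h2 : HasDerivAt (fun r : ℝ => r • unitVec θ) (unitVec θ) r := by
      simpa using (hasDerivAt_id r).smul_const (unitVec θ)
    exact h1.comp_hasDerivAt r h2
  have hz : ∀ r, R < r → r • unitVec θ ∉ tsupport φ := fun r hr =>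
    h _ (by rwa [norm_smul_unitVec (hR.trans hr).le])
  have hint : IntegrableOn (fun r : ℝ => fderiv ℝ φ (r • unitVec θ) (unitVec θ)) (Set.Ioi 0) := by
    have hc : Continuous fun r : ℝ => fderiv ℝ φ (r • unitVec θ) (unitVec θ) :=
      ((continuous_fderiv φ).comp (continuous_id.smul continuous_const)).clm_apply continuous_const
    refine (hc.continuousOn.integrableOn_compact (isCompact_Icc (a := 0) (b := R))
      ).of_forall_sdiff_eq_zero measurableSet_Ioi ?_
    rintro r ⟨hr, hn⟩
    have : R < r := by
      by_contra hle
      exact hn ⟨(Set.mem_Ioi.1 hr).le, not_lt.1 hle⟩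
    rw [fderiv_of_notMem_tsupport ℝ (hz r this)]
    rfl
  have hlim : Tendsto (fun r : ℝ => φ (r • unitVec θ)) atTop (𝓝 0) :=
    tendsto_const_nhds.congr' <| (eventually_gt_atTop R).mono fun r hr =>
      (image_eq_zero_of_notMem_tsupport (hz r hr)).symm
  rw [integral_Ioi_of_hasDerivAt_of_tendsto' (fun r _ => hd r) hint hlim]
  simp

/-- The integrand is `-(2π)⁻¹ r⁻¹ ∂ᵣφ`. The factor `r` of the area element cancels the singularity,
each ray contributes `-φ 0`, and the angle contributes `2π`. -/
theorem integral_kernel_curl (φ : Test) :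
    ∫ x, (kernel 0 x * (∂_{(EuclideanSpace.single 1 1 : Plane)} φ) x -
      kernel 1 x * (∂_{(EuclideanSpace.single 0 1 : Plane)} φ) x) = φ 0 := by
  obtain ⟨R, hR, h⟩ := φ.exists_radius
  simp_rw [kernel_pairing_fderiv]
  rw [integral_const_mul, integral_eq_polar]
  have hc : Continuous fun p : ℝ × ℝ => fderiv ℝ φ (p.1 • unitVec p.2) (unitVec p.2) :=
    ((continuous_fderiv φ).comp
      (continuous_fst.smul (continuous_unitVec.comp continuous_snd))).clm_apply
      (continuous_unitVec.comp continuous_snd)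
  have he : ∫ p in Set.Ioi (0 : ℝ) ×ˢ Set.Ioo (-Real.pi) Real.pi,
      p.1 • ((‖p.1 • unitVec p.2‖ ^ 2)⁻¹ *
        fderiv ℝ φ (p.1 • unitVec p.2) (p.1 • unitVec p.2)) =
      ∫ p in Set.Ioi (0 : ℝ) ×ˢ Set.Ioo (-Real.pi) Real.pi,
        fderiv ℝ φ (p.1 • unitVec p.2) (unitVec p.2) := by
    refine setIntegral_congr_fun (measurableSet_Ioi.prod measurableSet_Ioo) ?_
    rintro ⟨r, θ⟩ ⟨hr, -⟩
    have hr : 0 < r := hr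
    simp only [norm_smul_unitVec hr.le, map_smul, smul_eq_mul]
    field_simp
  rw [he, setIntegral_polar_radius_first hc (R := R)]
  · simp_rw [integral_radial_derivative]
    rw [setIntegral_const]
    simp only [Measure.real, Real.volume_Ioo, smul_eq_mul]
    rw [ENNReal.toReal_ofReal (by linarith [Real.pi_pos])]
    field_simp
    ring
  · intro r θ hr
    simp only
    rw [fderiv_of_notMem_tsupport ℝ (h _ (by rwa [norm_smul_unitVec (hR.trans hr).le]))]
    rfl

/-! ### The kernel averaged over circles -/

/-- For `w ≠ 0` write `w/(w - z) = 1 - z/(z - w)`; by Cauchy's formula the last fraction has average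
`1`. The factor `w` is divided out at the end, so `w = 0` is treated apart, through `∮ z⁻² = 0`. -/
theorem circleAverage_inv_sub_of_norm_lt {r : ℝ} (hr : 0 < r) {w : ℂ} (hw : ‖w‖ < r) :
    Real.circleAverage (fun z => (w - z)⁻¹) 0 r = 0 := by
  have hne : ∀ z ∈ Metric.sphere (0 : ℂ) r, w - z ≠ 0 := fun z hz h => by
    rw [sub_eq_zero.1 h] at hw
    simp at hz
    linarith
  by_cases h0 : w = 0
  · subst h0
    rw [Real.circleAverage_eq_circleIntegral hr.ne']
    have : (∮ z in C(0, r), (z - 0)⁻¹ • (0 - z)⁻¹) =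
        ∮ z in C(0, r), (-1 : ℂ) • (z - 0) ^ (-2 : ℤ) := by
      congr 1
      funext z
      rw [zpow_neg, zpow_ofNat, smul_eq_mul, smul_eq_mul, sub_zero, zero_sub, inv_neg, sq, mul_inv]
      ring
    rw [this, circleIntegral.integral_smul, circleIntegral.integral_sub_zpow_of_ne (by norm_num)]
    simp
  · have h1 := DiffContOnCl.circleAverage_smul_div (f := fun _ => (1 : ℂ)) (c := 0) (R := r) (w := w)
      diffContOnCl_const (by simpa [abs_of_pos hr] using hw)
    have h2 : Real.circleAverage (fun z => w • (w - z)⁻¹) 0 r =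
        Real.circleAverage (fun z => (1 : ℂ) - ((z - 0) / (z - w)) • (1 : ℂ)) 0 r := by
      refine Real.circleAverage_congr_sphere fun z hz => ?_
      rw [abs_of_pos hr] at hz
      have := hne z hz
      have h' : z - w ≠ 0 := fun h => this (by rw [← neg_sub, h, neg_zero])
      simp only [smul_eq_mul, mul_one, sub_zero]
      field_simp
      ring
    have hci : CircleIntegrable (fun z : ℂ => ((z - 0) / (z - w)) • (1 : ℂ)) 0 r := by
      refine ContinuousOn.circleIntegrable hr.le fun z hz => ContinuousAt.continuousWithinAt ?_
      have h' : z - w ≠ 0 := fun h => hne z hz (by rw [← neg_sub, h, neg_zero])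
      fun_prop (disch := assumption)
    rw [Real.circleAverage_fun_sub (circleIntegrable_const _ _ _) hci, h1,
      Real.circleAverage_const, sub_self] at h2
    have h3 := Real.circleAverage_fun_smul (a := w) (f := fun z : ℂ => (w - z)⁻¹) (c := 0) (R := r)
    rw [h3] at h2
    exact (smul_eq_zero.1 h2).resolve_left h0

/-- The pole lies outside the closed disc, so this is the mean value property at the centre. -/
theorem circleAverage_inv_sub_of_lt_norm {r : ℝ} (hr : 0 < r) {w : ℂ} (hw : r < ‖w‖) :
    Real.circleAverage (fun z => (w - z)⁻¹) 0 r = w⁻¹ := by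
  have h : DiffContOnCl ℂ (fun z => (w - z)⁻¹) (Metric.ball 0 |r|) := by
    apply DifferentiableOn.diffContOnCl
    rw [closure_ball _ (by simpa using hr.ne'), abs_of_pos hr]
    intro z hz
    have : w - z ≠ 0 := fun h => by
      rw [sub_eq_zero.1 h] at hw
      simp at hz
      linarith
    apply DifferentiableAt.differentiableWithinAt
    fun_prop (disch := assumption)
  simpa using h.circleAverage

theorem setIntegral_angle_eq_circleAverage (f : ℂ → ℂ) (r : ℝ) :
    ∫ θ in Set.Ioo (-Real.pi) Real.pi, f (toComplex (r • unitVec θ)) =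
      (2 * Real.pi) • Real.circleAverage f 0 r := by
  rw [Real.circleAverage_eq_integral_add (-Real.pi), smul_smul,
    mul_inv_cancel₀ (by positivity), one_smul]
  have h := intervalIntegral.integral_comp_add_right
    (a := 0) (b := 2 * Real.pi) (fun θ => f (circleMap 0 r θ)) (-Real.pi)
  rw [h, intervalIntegral.integral_of_le (by linarith [Real.pi_pos]), ← integral_Ioc_eq_integral_Ioo]
  have : 2 * Real.pi + -Real.pi = Real.pi := by ring
  simp_rw [toComplex_smul_unitVec_eq_circleMap, this, zero_add]

/-- The Cauchy kernel integrated against a rotationally symmetric density. -/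
theorem integral_radial_mul_inv_sub {q : Plane → ℝ} {w c : ℂ} {R : ℝ}
    (hrad : ∀ x y : Plane, ‖x‖ = ‖y‖ → q x = q y) (hq : Continuous q)
    (hR : ∀ x, R < ‖x‖ → q x = 0)
    (hcont : Continuous fun x => q x • (w - toComplex x)⁻¹)
    (havg : ∀ x, 0 < ‖x‖ → q x ≠ 0 → Real.circleAverage (fun z => (w - z)⁻¹) 0 ‖x‖ = c) :
    ∫ x, q x • (w - toComplex x)⁻¹ = (∫ x, q x) • c := by
  have hu : Continuous fun p : ℝ × ℝ => p.1 • unitVec p.2 :=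
    continuous_fst.smul (continuous_unitVec.comp continuous_snd)
  rw [← integral_smul_const, integral_eq_polar, integral_eq_polar,
    setIntegral_polar_angle_first (G := fun p : ℝ × ℝ => p.1 • (q (p.1 • unitVec p.2) •
      (w - toComplex (p.1 • unitVec p.2))⁻¹)) (R := max R 0),
    setIntegral_polar_angle_first (G := fun p : ℝ × ℝ => p.1 • (q (p.1 • unitVec p.2) • c))
      (R := max R 0)]
  · refine setIntegral_congr_fun measurableSet_Ioi fun r hr => ?_
    have hr : 0 < r := hr
    have hθ : ∀ θ, q (r • unitVec θ) = q (r • unitVec 0) := fun θ =>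
      hrad _ _ (by rw [norm_smul_unitVec hr.le, norm_smul_unitVec hr.le])
    simp only [hθ]
    rw [integral_smul, integral_smul, integral_smul, integral_smul]
    -- Only circles that meet the support of `q` have a known average; on the others both sides
    -- vanish.
    by_cases h0 : q (r • unitVec 0) = 0
    · rw [h0, zero_smul, zero_smul]
    · have h := havg (r • unitVec 0) (by rwa [norm_smul_unitVec hr.le]) h0
      rw [norm_smul_unitVec hr.le] at h
      rw [setIntegral_angle_eq_circleAverage (fun z => (w - z)⁻¹), h, setIntegral_const]
      congr 3
      simp only [Measure.real, Real.volume_Ioo]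
      rw [ENNReal.toReal_ofReal (by linarith [Real.pi_pos])]
      ring
  · exact continuous_fst.smul ((hq.comp hu).smul continuous_const)
  · intro r θ hr
    rw [max_lt_iff] at hr
    simp only
    rw [hR _ (by rw [norm_smul_unitVec hr.2.le]; exact hr.1), zero_smul, smul_zero]
  · exact continuous_fst.smul (hcont.comp hu)
  · intro r θ hr
    rw [max_lt_iff] at hr
    simp only
    rw [hR _ (by rw [norm_smul_unitVec hr.2.le]; exact hr.1), zero_smul, smul_zero]

/-! ### Annular mollifiers -/

/-- Mollifiers supported in the annulus `1 ≤ ‖x‖ ≤ 2`. -/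
def IsAnnular (ρ : Test) : Prop := ∀ x, ρ x ≠ 0 → 1 ≤ ‖x‖ ∧ ‖x‖ ≤ 2

/-- The defining limits hold for every radial mollifier, so uniqueness may use a convenient one. The
hole around the centre and the bounded support are what make the mollified kernel exact near and far
from the origin. -/
theorem exists_annular_mollifier : ∃ ρ : Test, IsRadialMollifier ρ ∧ IsAnnular ρ := by
  set f : Plane → ℝ := fun x =>
    Real.smoothTransition (‖x‖ ^ 2 - 1) * Real.smoothTransition (4 - ‖x‖ ^ 2) with hf
  have hsmooth : ContDiff ℝ (⊤ : ℕ∞) f :=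
    (Real.smoothTransition.contDiff.comp ((contDiff_norm_sq ℝ).sub contDiff_const)).mul
      (Real.smoothTransition.contDiff.comp (contDiff_const.sub (contDiff_norm_sq ℝ)))
  have hann : ∀ x, f x ≠ 0 → 1 ≤ ‖x‖ ∧ ‖x‖ ≤ 2 := by
    intro x hx
    constructor
    · by_contra h
      apply hx
      rw [hf]
      simp only
      rw [Real.smoothTransition.zero_of_nonpos (by nlinarith [norm_nonneg x]), zero_mul]
    · by_contra h
      apply hx
      rw [hf]
      simp only
      rw [Real.smoothTransition.zero_of_nonpos (x := 4 - ‖x‖ ^ 2) (by nlinarith [norm_nonneg x]),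
        mul_zero]
  have hc : HasCompactSupport f := by
    refine HasCompactSupport.intro (isCompact_closedBall (0 : Plane) 2) fun x hx => ?_
    by_contra h
    exact hx (by simpa using (hann x h).2)
  have hnn : ∀ x, 0 ≤ f x := fun x =>
    mul_nonneg (Real.smoothTransition.nonneg _) (Real.smoothTransition.nonneg _)
  have hpos : 0 < ∫ x, f x := by
    refine hsmooth.continuous.integral_pos_of_hasCompactSupport_nonneg_nonzero
      (x := (3 / 2 : ℝ) • unitVec 0) hc hnn ?_
    have hn := norm_smul_unitVec (r := 3 / 2) (by norm_num) 0
    rw [hf]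
    simp only
    rw [hn]
    exact (mul_pos (Real.smoothTransition.pos_of_pos (by norm_num))
      (Real.smoothTransition.pos_of_pos (by norm_num))).ne'
  have happ : ∀ x, toTest (fun x => (∫ y, f y)⁻¹ * f x) x = (∫ y, f y)⁻¹ * f x :=
    toTest_apply (contDiff_const.mul hsmooth) hc.mul_left
  refine ⟨toTest fun x => (∫ y, f y)⁻¹ * f x, ⟨fun x => ?_, fun x y hxy => ?_, ?_⟩, fun x hx => ?_⟩
  · rw [happ]
    exact mul_nonneg (inv_nonneg.2 hpos.le) (hnn x)
  · rw [happ, happ, hf]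
    simp only [hxy]
  · simp_rw [happ]
    rw [integral_const_mul, inv_mul_cancel₀ hpos.ne']
  · rw [happ] at hx
    exact hann x (right_ne_zero_of_mul hx)

theorem IsAnnular.rescale {ρ : Test} (h : IsAnnular ρ) {ε : ℝ} (hε : 0 < ε) {x : Plane}
    (hx : rescale ρ ε x ≠ 0) : ε ≤ ‖x‖ ∧ ‖x‖ ≤ 2 * ε := by
  have := h _ (right_ne_zero_of_mul hx)
  rw [norm_smul, norm_inv, Real.norm_of_nonneg hε.le, inv_mul_eq_div, le_div_iff₀ hε,
    div_le_iff₀ hε] at this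
  simpa using this

theorem IsAnnular.tsupport_rescale {ρ : Test} (h : IsAnnular ρ) {ε : ℝ} (hε : 0 < ε) {x : Plane}
    (hx : x ∈ tsupport (Volterra.rescale ρ ε)) : ε ≤ ‖x‖ ∧ ‖x‖ ≤ 2 * ε := by
  have hcl : IsClosed {x : Plane | ε ≤ ‖x‖ ∧ ‖x‖ ≤ 2 * ε} :=
    (isClosed_le continuous_const continuous_norm).inter
      (isClosed_le continuous_norm continuous_const)
  exact closure_minimal (fun y hy => h.rescale hε hy) hcl hx

/-- The condition on `w` keeps the pole off the supporting annulus, so the integrand is continuous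
and can be integrated circle by circle. -/
theorem IsAnnular.integral_rescale_mul_inv {ρ : Test} (hr : IsRadialMollifier ρ) (h : IsAnnular ρ)
    {ε : ℝ} (hε : 0 < ε) {w c : ℂ} (hw : ‖w‖ < ε ∨ 2 * ε < ‖w‖)
    (hc : ∀ r, ε ≤ r → r ≤ 2 * ε → Real.circleAverage (fun z => (w - z)⁻¹) 0 r = c) :
    Integrable (fun y => Volterra.rescale ρ ε y • (w - toComplex y)⁻¹) ∧
      ∫ y, Volterra.rescale ρ ε y • (w - toComplex y)⁻¹ = c := by
  have hq := (contDiff_rescale ρ ε).continuous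
  have hcont : Continuous fun y => Volterra.rescale ρ ε y • (w - toComplex y)⁻¹ := by
    refine continuous_of_tsupport fun y hy => ?_
    have hy' := h.tsupport_rescale hε (closure_mono (Function.support_smul_subset_left _ _) hy)
    have hne : w - toComplex y ≠ 0 := fun h0 => by
      rw [sub_eq_zero.1 h0, LinearIsometryEquiv.norm_map] at hw
      rcases hw with hw | hw <;> linarith
    exact hq.continuousAt.smul
      ((continuousAt_const.sub toComplex.continuous.continuousAt).inv₀ hne)
  refine ⟨hcont.integrable_of_hasCompactSupport
    ((hasCompactSupport_rescale ρ hε).smul_right), ?_⟩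
  rw [integral_radial_mul_inv_sub (c := c) (R := 2 * ε) (fun x y => hr.rescale_radial ε) hq ?_ hcont
    ?_, integral_rescale ρ hε, hr.integral_eq_one, one_smul]
  · intro x hx
    by_contra h0
    linarith [(h.rescale hε h0).2]
  · intro x _ h0
    exact hc _ (h.rescale hε h0).1 (h.rescale hε h0).2

theorem mollify_kernel_eq {ρ : Test} {ε : ℝ} (hε : 0 < ε) {x : Plane} {c : ℂ}
    (h : Integrable (fun y => rescale ρ ε y • (toComplex x - toComplex y)⁻¹) ∧
      ∫ y, rescale ρ ε y • (toComplex x - toComplex y)⁻¹ = c) (k : Fin 3) :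
    mollify ρ ε (ofFun (kernel k)) x = (2 * Real.pi)⁻¹ * ![c.im, c.re, 0] k := by
  rw [mollify_ofFun_sub ρ hε (locallyIntegrable_kernel k)]
  have him : ∫ y, (rescale ρ ε y • (toComplex x - toComplex y)⁻¹).im = c.im := by
    rw [← h.2]
    exact Complex.imCLM.integral_comp_comm h.1
  have hre : ∫ y, (rescale ρ ε y • (toComplex x - toComplex y)⁻¹).re = c.re := by
    rw [← h.2]
    exact Complex.reCLM.integral_comp_comm h.1
  unfold kernel
  simp_rw [mul_assoc]
  rw [integral_const_mul]
  congr 1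
  fin_cases k
  · refine Eq.trans ?_ him
    congr 1
    funext y
    simp [mul_comm]
  · refine Eq.trans ?_ hre
    congr 1
    funext y
    simp [mul_comm]
  · simp

/-- Every circle about `x` of radius between `ε` and `2ε` encloses the pole at the origin. -/
theorem mollify_kernel_of_norm_lt {ρ : Test} (hr : IsRadialMollifier ρ) (h : IsAnnular ρ) {ε : ℝ}
    (hε : 0 < ε) {x : Plane} (hx : ‖x‖ < ε) (k : Fin 3) :
    mollify ρ ε (ofFun (kernel k)) x = 0 := by
  have hx' : ‖toComplex x‖ < ε := by rwa [LinearIsometryEquiv.norm_map]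
  rw [mollify_kernel_eq hε (h.integral_rescale_mul_inv hr hε (w := toComplex x) (c := 0)
    (.inl hx') fun r h1 _ => circleAverage_inv_sub_of_norm_lt (hε.trans_le h1) (hx'.trans_le h1)) k]
  fin_cases k <;> simp

/-- No circle about `x` of radius at most `2ε` reaches the pole, so averaging reproduces the value
at the centre. -/
theorem mollify_kernel_of_lt_norm {ρ : Test} (hr : IsRadialMollifier ρ) (h : IsAnnular ρ) {ε : ℝ}
    (hε : 0 < ε) {x : Plane} (hx : 2 * ε < ‖x‖) (k : Fin 3) :
    mollify ρ ε (ofFun (kernel k)) x = kernel k x := by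
  have hx' : 2 * ε < ‖toComplex x‖ := by rwa [LinearIsometryEquiv.norm_map]
  exact mollify_kernel_eq hε (h.integral_rescale_mul_inv hr hε (w := toComplex x)
    (.inr hx') fun r h1 h2 => circleAverage_inv_sub_of_lt_norm (hε.trans_le h1)
      (h2.trans_lt hx')) k

/-! ### The plane potential of a measure -/

/-- The field of a distribution `μ` of straight dislocations with unit Burgers vectors. -/
def potential (μ : Measure Plane) (k : Fin 3) (x : Plane) : ℝ := ∫ ξ, kernel k (x - ξ) ∂μ

section Potential

open scoped Pointwise

variable {μ : Measure Plane} [IsFiniteMeasure μ] {K : Set Plane}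

theorem integrable_kernel_sub (hK : IsCompact K) (hμ : μ Kᶜ = 0) (k : Fin 3) {x : Plane}
    (hx : x ∉ K) : Integrable (fun ξ => kernel k (x - ξ)) μ := by
  obtain ⟨d, hd, hball⟩ := Metric.isOpen_iff.1 hK.isClosed.isOpen_compl x hx
  refine Integrable.of_bound (C := (2 * Real.pi)⁻¹ * d⁻¹)
    ((measurable_kernel k).comp (measurable_const.sub measurable_id)).aestronglyMeasurable ?_
  filter_upwards [mem_ae_iff.2 hμ] with ξ hξ
  refine (abs_kernel_le k _).trans ?_
  gcongr
  by_contra hlt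
  refine hball (a := ξ) ?_ hξ
  rw [Metric.mem_ball, dist_comm, dist_eq_norm]
  exact not_le.1 hlt

/-- This licenses Fubini for the potential. For `ξ ∈ K` a translation bounds the inner integral over
`C` by the integral of the absolute value of the kernel over the compact set `C - K`, uniformly in
`ξ`. -/
theorem integrable_kernel_sub_prod (hK : IsCompact K) (hμ : μ Kᶜ = 0) (k : Fin 3) {C : Set Plane}
    (hC : IsCompact C) :
    Integrable (fun p : Plane × Plane => kernel k (p.1 - p.2)) ((volume.restrict C).prod μ) := by
  have hm : Measurable fun p : Plane × Plane => kernel k (p.1 - p.2) :=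
    (measurable_kernel k).comp (measurable_fst.sub measurable_snd)
  have hloc := locallyIntegrable_kernel k
  have hcomp : IsCompact (C - K) := by
    rw [sub_eq_add_neg]
    exact hC.add hK.neg
  have hfin := hloc.integrableOn_isCompact hcomp
  have hpre : ∀ ξ ∈ K, C ⊆ (fun x => x - ξ) ⁻¹' (C - K) := fun ξ hξ x hx => Set.sub_mem_sub hx hξ
  have hmp : ∀ ξ : Plane, MeasurePreserving (fun x : Plane => x - ξ) volume volume := fun ξ =>
    measurePreserving_sub_right volume ξ
  have hemb : ∀ ξ : Plane, MeasurableEmbedding fun x : Plane => x - ξ := fun ξ =>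
    (Homeomorph.subRight ξ).measurableEmbedding
  have hint : ∀ ξ ∈ K, IntegrableOn (fun x => kernel k (x - ξ))
      ((fun x => x - ξ) ⁻¹' (C - K)) := fun ξ _ =>
    ((hmp ξ).integrableOn_comp_preimage (hemb ξ)).2 hfin
  rw [integrable_prod_iff' hm.aestronglyMeasurable]
  have hae : ∀ᵐ ξ ∂μ, ξ ∈ K := mem_ae_iff.2 hμ
  refine ⟨hae.mono fun ξ hξ => (hint ξ hξ).mono_set (hpre ξ hξ), ?_⟩
  refine Integrable.of_bound (C := ∫ x in C - K, ‖kernel k x‖)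
    (hm.norm.stronglyMeasurable.integral_prod_left (μ := volume.restrict C)).aestronglyMeasurable ?_
  filter_upwards [hae] with ξ hξ
  rw [Real.norm_of_nonneg (integral_nonneg fun _ => norm_nonneg _),
    ← (hmp ξ).setIntegral_preimage_emb (hemb ξ) (fun x => ‖kernel k x‖)]
  exact setIntegral_mono_set (hint ξ hξ).norm (.of_forall fun _ => norm_nonneg _)
    (hpre ξ hξ).eventuallyLE

theorem locallyIntegrable_potential (hK : IsCompact K) (hμ : μ Kᶜ = 0) (k : Fin 3) :
    LocallyIntegrable (potential μ k) := by
  rw [locallyIntegrable_iff]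
  intro C hC
  exact (integrable_kernel_sub_prod hK hμ k hC).integral_prod_left

theorem integral_potential_mul (hK : IsCompact K) (hμ : μ Kᶜ = 0) (k : Fin 3) (ψ : Test) :
    Integrable (fun ξ => ∫ x, kernel k (x - ξ) * ψ x) μ ∧
    ∫ x, potential μ k x * ψ x = ∫ ξ, (∫ x, kernel k (x - ξ) * ψ x) ∂μ := by
  have hC : IsCompact (tsupport ψ) := ψ.hasCompactSupport
  have hz : ∀ x, x ∉ tsupport ψ → ψ x = 0 := fun x hx => image_eq_zero_of_notMem_tsupport hx
  obtain ⟨B, hB⟩ := ψ.continuous.bounded_above_of_compact_support ψ.hasCompactSupport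
  have hint : Integrable (fun p : Plane × Plane => kernel k (p.1 - p.2) * ψ p.1)
      ((volume.restrict (tsupport ψ)).prod μ) :=
    (integrable_kernel_sub_prod hK hμ k hC).mul_bdd (c := B)
      (ψ.continuous.comp continuous_fst).aestronglyMeasurable (.of_forall fun p => hB p.1)
  have hset : ∀ f : Plane → ℝ, ∫ x in tsupport ψ, f x * ψ x = ∫ x, f x * ψ x := fun f =>
    setIntegral_eq_integral_of_forall_compl_eq_zero fun x hx => by rw [hz x hx, mul_zero]
  refine ⟨?_, ?_⟩
  · have := hint.integral_prod_right
    simpa only [hset fun x => kernel k (x - _)] using this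
  · rw [← hset]
    simp only [← fun ξ => hset fun x => kernel k (x - ξ)]
    rw [← integral_integral_swap hint]
    simp_rw [integral_mul_const]
    rfl

theorem integral_kernel_sub_curl (φ : Test) (ξ : Plane) :
    (∫ x, kernel 0 (x - ξ) * (∂_{(EuclideanSpace.single 1 1 : Plane)} φ) x) -
      ∫ x, kernel 1 (x - ξ) * (∂_{(EuclideanSpace.single 0 1 : Plane)} φ) x = φ ξ := by
  have hsm : ContDiff ℝ (⊤ : ℕ∞) fun x => φ (x + ξ) :=
    φ.contDiff.comp (contDiff_id.add contDiff_const)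
  have hcs : HasCompactSupport fun x => φ (x + ξ) :=
    φ.hasCompactSupport.comp_homeomorph (Homeomorph.addRight ξ)
  set ψ : Test := toTest fun x => φ (x + ξ) with hψ
  have hψx : ⇑ψ = fun x => φ (x + ξ) := funext fun x => toTest_apply hsm hcs x
  have hd : ∀ (v x : Plane), (∂_{v} φ) (x + ξ) = (∂_{v} ψ) x := fun v x => by
    rw [Test.lineDeriv_apply, Test.lineDeriv_apply, hψx, fderiv_comp_add_right]
  have h := integral_kernel_curl ψ
  rw [integral_sub (Test.integrable_mul _ (locallyIntegrable_kernel 0))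
    (Test.integrable_mul _ (locallyIntegrable_kernel 1))] at h
  rw [← integral_add_right_eq_self (fun x => kernel 0 (x - ξ) * _) ξ,
    ← integral_add_right_eq_self (fun x => kernel 1 (x - ξ) * _) ξ]
  simp only [add_sub_cancel_right, hd]
  rw [h, hψx]
  simp

/-- By Fubini the weak curl of the superposition is the superposition of the weak curls `δ_ξ` of the
translated kernels. -/
theorem curl_potential (hK : IsCompact K) (hμ : μ Kᶜ = 0) :
    ∂_{(EuclideanSpace.single 0 1 : Plane)} (ofFun (potential μ 1)) -
      ∂_{(EuclideanSpace.single 1 1 : Plane)} (ofFun (potential μ 0)) = ofMeasure μ := by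
  ext φ
  have h0 := integral_potential_mul hK hμ 0 (∂_{(EuclideanSpace.single 1 1 : Plane)} φ)
  have h1 := integral_potential_mul hK hμ 1 (∂_{(EuclideanSpace.single 0 1 : Plane)} φ)
  change (∂_{(EuclideanSpace.single 0 1 : Plane)} (ofFun (potential μ 1))) φ -
    (∂_{(EuclideanSpace.single 1 1 : Plane)} (ofFun (potential μ 0))) φ = _
  rw [Distribution.lineDerivOp_apply_apply, Distribution.lineDerivOp_apply_apply, map_neg, map_neg,
    ofFun_apply (locallyIntegrable_potential hK hμ 1),
    ofFun_apply (locallyIntegrable_potential hK hμ 0), ofMeasure_apply, h0.2, h1.2,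
    neg_sub_neg, ← integral_sub h0.1 h1.1]
  simp_rw [integral_kernel_sub_curl]

end Potential

/-! ### Reflection symmetry across the `x`-axis -/

/-- The reflection `y ↦ -y` of the plane. -/
def reflection : Plane ≃ₗᵢ[ℝ] Plane :=
  (toComplex.trans Complex.conjLIE).trans toComplex.symm

@[simp]
theorem reflection_zero (x : Plane) : reflection x 0 = x 0 := by
  rw [← toComplex_re, ← toComplex_re]
  simp [reflection]

@[simp]
theorem reflection_one (x : Plane) : reflection x 1 = -x 1 := by
  rw [← toComplex_im, ← toComplex_im]
  simp [reflection]

theorem potential_reflection {μ : Measure Plane} (hμ : ∀ᵐ ξ ∂μ, ξ 1 = 0) (x : Plane) :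
    potential μ 0 (reflection x) = -potential μ 0 x := by
  unfold potential
  rw [← integral_neg]
  refine integral_congr_ae ?_
  filter_upwards [hμ] with ξ hξ
  simp [kernel_zero_apply, hξ]
  ring

/-- Reflecting the variable of integration changes its sign: `x` is fixed, the potential is odd and
the radial mollifier is even. This is the cancellation behind the existence of the Levi-Civita
connection. -/
theorem mollify_potential_eq_zero {ρ : Test} (hr : IsRadialMollifier ρ) {ε : ℝ} (hε : 0 < ε)
    {μ : Measure Plane} (hl : LocallyIntegrable (potential μ 0)) (hμ : ∀ᵐ ξ ∂μ, ξ 1 = 0)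
    {x : Plane} (hx : x 1 = 0) : mollify ρ ε (ofFun (potential μ 0)) x = 0 := by
  rw [mollify_ofFun_sub ρ hε hl]
  have hRx : reflection x = x := by
    ext i
    fin_cases i <;> simp [hx]
  have h := reflection.measurePreserving.integral_comp
    reflection.toHomeomorph.measurableEmbedding fun y => potential μ 0 (x - y) * rescale ρ ε y
  have h2 : ∀ y, potential μ 0 (x - reflection y) * rescale ρ ε (reflection y) =
      -(potential μ 0 (x - y) * rescale ρ ε y) := fun y => by
    rw [hr.rescale_radial ε (reflection.norm_map y)]
    conv_lhs => rw [← hRx, ← map_sub, potential_reflection hμ]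
    ring
  simp_rw [h2] at h
  rw [integral_neg] at h
  linarith

/-! ### The Biot--Savart integral along a straight line -/

theorem integrable_inv_sqrt_cube {a : ℝ} (ha : 0 < a) :
    Integrable fun t : ℝ => (Real.sqrt (a + t ^ 2) ^ 3)⁻¹ := by
  have hm : 0 < min a 1 := lt_min ha one_pos
  have hpos : ∀ t : ℝ, 0 < a + t ^ 2 := fun t => by positivity
  have hc : Continuous fun t : ℝ => (Real.sqrt (a + t ^ 2) ^ 3)⁻¹ :=
    Continuous.inv₀ (by fun_prop) fun t => (pow_pos (Real.sqrt_pos.2 (hpos t)) 3).ne'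
  -- The bound comes from `(a + t²)^(3/2) ≥ √a · min a 1 · (1 + t²)`.
  refine (integrable_inv_one_add_sq.const_mul ((Real.sqrt a)⁻¹ * (min a 1)⁻¹)).mono'
    hc.aestronglyMeasurable (.of_forall fun t => ?_)
  have hs := Real.sqrt_pos.2 (hpos t)
  rw [Real.norm_of_nonneg (by positivity), pow_succ', Real.sq_sqrt (hpos t).le, mul_inv, mul_assoc,
    ← mul_inv (min a 1)]
  gcongr
  · nlinarith [sq_nonneg t]
  · nlinarith [min_le_left a 1, min_le_right a 1, sq_nonneg t]

theorem tendsto_div_sqrt_atTop {a : ℝ} (ha : 0 < a) :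
    Tendsto (fun t : ℝ => t / (a * Real.sqrt (a + t ^ 2))) atTop (𝓝 a⁻¹) := by
  have h1 : Tendsto (fun t : ℝ => (a * Real.sqrt (a * (t⁻¹) ^ 2 + 1))⁻¹) atTop (𝓝 a⁻¹) := by
    have h : Tendsto (fun t : ℝ => a * Real.sqrt (a * (t⁻¹) ^ 2 + 1)) atTop
        (𝓝 (a * Real.sqrt (a * 0 ^ 2 + 1))) :=
      (((tendsto_inv_atTop_zero.pow 2).const_mul a).add_const 1).sqrt.const_mul a
    simpa using h.inv₀ (by simpa using ha.ne')
  refine h1.congr' ?_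
  filter_upwards [eventually_gt_atTop 0] with t ht
  have : a + t ^ 2 = t ^ 2 * (a * (t⁻¹) ^ 2 + 1) := by field_simp
  rw [this, Real.sqrt_mul (sq_nonneg t), Real.sqrt_sq ht.le]
  have : 0 < Real.sqrt (a * (t⁻¹) ^ 2 + 1) := Real.sqrt_pos.2 (by positivity)
  field_simp

theorem integral_inv_sqrt_cube {a : ℝ} (ha : 0 < a) :
    ∫ t : ℝ, (Real.sqrt (a + t ^ 2) ^ 3)⁻¹ = 2 / a := by
  have hbot : Tendsto (fun t : ℝ => t / (a * Real.sqrt (a + t ^ 2))) atBot (𝓝 (-a⁻¹)) := by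
    have h := ((tendsto_div_sqrt_atTop ha).comp tendsto_neg_atBot_atTop).neg
    refine h.congr fun t => ?_
    simp [neg_div]
  -- The antiderivative `t / (a √(a + t²))` tends to `±1/a` at `±∞`.
  rw [integral_of_hasDerivAt_of_tendsto (f := fun t => t / (a * Real.sqrt (a + t ^ 2)))
    (fun t => ?_) (integrable_inv_sqrt_cube ha) hbot (tendsto_div_sqrt_atTop ha)]
  · field_simp
    ring
  · have hpos : 0 < a + t ^ 2 := by positivity
    have hs := Real.sqrt_pos.2 hpos
    have h1 : HasDerivAt (fun t : ℝ => a + t ^ 2) (2 * t) t := by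
      simpa using (hasDerivAt_pow 2 t).const_add a
    have h2 := (hasDerivAt_id t).div ((h1.sqrt hpos.ne').const_mul a) (by positivity)
    refine h2.congr_deriv ?_
    have hsq := Real.sq_sqrt hpos.le
    set s := Real.sqrt (a + t ^ 2)
    simp only [id]
    field_simp
    linear_combination hsq

/-- The projection of a point of space to the plane. -/
def proj (p : EuclideanSpace ℝ (Fin 3)) : Plane := !₂[p 0, p 1]

theorem norm_sub_eq_sqrt (p : EuclideanSpace ℝ (Fin 3)) (ξ : Plane) (t : ℝ) :
    ‖p - !₂[ξ 0, ξ 1, t]‖ = Real.sqrt (‖proj p - ξ‖ ^ 2 + (t - p 2) ^ 2) := by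
  rw [EuclideanSpace.norm_eq, EuclideanSpace.real_norm_sq_eq]
  congr 1
  simp [Fin.sum_univ_succ, proj]
  ring

/-- The component along the line drops out of the cross product. The factor `‖proj p - ξ‖ ^ 2`
clears the denominator of the kernel, so the identity persists on the line itself. -/
theorem cross_eq_kernel (b : ℝ) (p : EuclideanSpace ℝ (Fin 3)) (ξ : Plane) (t : ℝ) (k : Fin 3) :
    crossProduct ![0, 0, b] (p - !₂[ξ 0, ξ 1, t]).ofLp k =
      2 * Real.pi * b * ‖proj p - ξ‖ ^ 2 * kernel k (proj p - ξ) := by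
  have hn : ‖proj p - ξ‖ ^ 2 = (proj p - ξ) 0 ^ 2 + (proj p - ξ) 1 ^ 2 := by
    rw [EuclideanSpace.real_norm_sq_eq, Fin.sum_univ_two]
  by_cases h0 : ‖proj p - ξ‖ ^ 2 = 0
  · have h : proj p - ξ = 0 := by simpa using h0
    have h1 : p 0 - ξ 0 = 0 := congrArg (fun v : Plane => v 0) h
    have h2 : p 1 - ξ 1 = 0 := congrArg (fun v : Plane => v 1) h
    rw [h0]
    fin_cases k <;> simp [cross_apply, Matrix.vecHead, Matrix.vecTail, h1, h2]
  · rw [hn] at h0 ⊢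
    fin_cases k
    · simp only [Fin.zero_eta, kernel_zero_apply]
      field_simp
      simp [cross_apply, proj, Matrix.vecHead, Matrix.vecTail]
    · simp only [Fin.mk_one, kernel_one_apply]
      field_simp
      simp [cross_apply, proj, Matrix.vecHead, Matrix.vecTail]
    · simp [cross_apply]

section BiotSavart

variable {μ : Measure Plane} [IsFiniteMeasure μ] {K : Set Plane}

/-- With `r = ‖proj p - ξ‖`, the line integral `2/r²` meets the factor `2π b r²` of the cross
product, and `1/(4π)` leaves exactly `b`. -/
theorem biotSavart_eq_potential (b : ℝ) (hK : IsCompact K) (hμ : μ Kᶜ = 0)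
    {p : EuclideanSpace ℝ (Fin 3)} (hp : proj p ∉ K) :
    biotSavart b μ p = fun k => b * potential μ k (proj p) := by
  have hform : ∀ (k : Fin 3) (ξ : Plane × ℝ), ((‖p - !₂[ξ.1 0, ξ.1 1, ξ.2]‖ ^ 3)⁻¹ •
      crossProduct ![0, 0, b] (p - !₂[ξ.1 0, ξ.1 1, ξ.2]).ofLp) k =
      (Real.sqrt (‖proj p - ξ.1‖ ^ 2 + (ξ.2 - p 2) ^ 2) ^ 3)⁻¹ *
        (2 * Real.pi * b * ‖proj p - ξ.1‖ ^ 2 * kernel k (proj p - ξ.1)) := fun k ξ => by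
    rw [Pi.smul_apply, cross_eq_kernel, norm_sub_eq_sqrt, smul_eq_mul]
  have hpos : ∀ ξ ∈ K, 0 < ‖proj p - ξ‖ ^ 2 := fun ξ hξ => by
    have : proj p - ξ ≠ 0 := fun h => hp (by rwa [sub_eq_zero.1 h])
    positivity
  have hline : ∀ ξ ∈ K, (Integrable fun t : ℝ =>
      (Real.sqrt (‖proj p - ξ‖ ^ 2 + (t - p 2) ^ 2) ^ 3)⁻¹) ∧
      ∫ t : ℝ, (Real.sqrt (‖proj p - ξ‖ ^ 2 + (t - p 2) ^ 2) ^ 3)⁻¹ =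
        2 / ‖proj p - ξ‖ ^ 2 := fun ξ hξ => by
    have ha := hpos ξ hξ
    refine ⟨(integrable_inv_sqrt_cube ha).comp_sub_right (p 2), ?_⟩
    rw [integral_sub_right_eq_self (fun t : ℝ => (Real.sqrt (‖proj p - ξ‖ ^ 2 + t ^ 2) ^ 3)⁻¹),
      integral_inv_sqrt_cube ha]
  have hae : ∀ᵐ ξ ∂μ, ξ ∈ K := mem_ae_iff.2 hμ
  have hint : ∀ k, Integrable (fun ξ : Plane × ℝ =>
      (Real.sqrt (‖proj p - ξ.1‖ ^ 2 + (ξ.2 - p 2) ^ 2) ^ 3)⁻¹ *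
        (2 * Real.pi * b * ‖proj p - ξ.1‖ ^ 2 * kernel k (proj p - ξ.1))) (μ.prod volume) := by
    intro k
    have hmk : Measurable fun ξ : Plane × ℝ => kernel k (proj p - ξ.1) :=
      (measurable_kernel k).comp (measurable_const.sub measurable_fst)
    have hm : Measurable fun ξ : Plane × ℝ =>
        (Real.sqrt (‖proj p - ξ.1‖ ^ 2 + (ξ.2 - p 2) ^ 2) ^ 3)⁻¹ *
          (2 * Real.pi * b * ‖proj p - ξ.1‖ ^ 2 * kernel k (proj p - ξ.1)) := by
      fun_prop
    rw [integrable_prod_iff hm.aestronglyMeasurable]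
    refine ⟨hae.mono fun ξ hξ => (hline ξ hξ).1.mul_const
      (2 * Real.pi * b * ‖proj p - ξ‖ ^ 2 * kernel k (proj p - ξ)), ?_⟩
    -- The constant is `2π|b| r²` times the line integral `2/r²`.
    refine ((integrable_kernel_sub hK hμ k hp).norm.const_mul (4 * Real.pi * |b|)).congr ?_
    filter_upwards [hae] with ξ hξ
    have := hpos ξ hξ
    have hn : ‖proj p - ξ‖ ≠ 0 := fun h0 => by simp [h0] at this
    simp only [norm_mul, norm_inv, norm_pow, norm_norm, Real.norm_of_nonneg (Real.sqrt_nonneg _),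
      Real.norm_of_nonneg Real.pi_pos.le, Real.norm_ofNat]
    rw [integral_mul_const, (hline ξ hξ).2]
    simp only [Real.norm_eq_abs]
    field_simp
    ring
  funext k
  unfold biotSavart
  rw [Pi.smul_apply, eval_integral fun i => by simp only [hform]; exact hint i]
  simp only [hform]
  rw [integral_prod _ (hint k)]
  simp only [integral_mul_const]
  unfold potential
  rw [smul_eq_mul, ← integral_const_mul, ← integral_const_mul]
  refine integral_congr_ae ?_
  filter_upwards [hae] with ξ hξ
  have := hpos ξ hξ
  have hn : ‖proj p - ξ‖ ≠ 0 := fun h0 => by simp [h0] at this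
  rw [(hline ξ hξ).2]
  field_simp
  ring

theorem plasticField_eq_potential (b : ℝ) (hK : IsCompact K) (hμ : μ Kᶜ = 0) {x : Plane}
    (hx : x ∉ K) (k : Fin 3) : plasticField b μ k x = b * potential μ k x := by
  have hp : proj !₂[x 0, x 1, 0] = x := by
    ext i
    fin_cases i <;> simp [proj]
  unfold plasticField
  rw [biotSavart_eq_potential b hK hμ (by rwa [hp]), hp]

theorem plasticField_ae_eq (b : ℝ) (hK : IsCompact K) (hμ : μ Kᶜ = 0) (hv : volume K = 0)
    (k : Fin 3) : plasticField b μ k =ᵐ[volume] fun x => b * potential μ k x := by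
  filter_upwards [compl_mem_ae_iff.2 hv] with x hx
  exact plasticField_eq_potential b hK hμ hx k

theorem locallyIntegrable_plasticField (b : ℝ) (hK : IsCompact K) (hμ : μ Kᶜ = 0)
    (hv : volume K = 0) (k : Fin 3) : LocallyIntegrable (plasticField b μ k) := by
  have h := (locallyIntegrable_potential hK hμ k).smul b
  rw [locallyIntegrable_iff] at h ⊢
  exact fun C hC => (h C hC).congr (ae_restrict_of_ae (plasticField_ae_eq b hK hμ hv k).symm)

theorem ofFun_plasticField (b : ℝ) (hK : IsCompact K) (hμ : μ Kᶜ = 0) (hv : volume K = 0)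
    (k : Fin 3) : ofFun (plasticField b μ k) = b • ofFun (potential μ k) := by
  ext φ
  change _ = b * ofFun (potential μ k) φ
  rw [ofFun_apply (locallyIntegrable_plasticField b hK hμ hv k),
    ofFun_apply (locallyIntegrable_potential hK hμ k), ← integral_const_mul]
  refine integral_congr_ae ?_
  filter_upwards [plasticField_ae_eq b hK hμ hv k] with x hx
  rw [hx, mul_assoc]

end BiotSavart

/-! ### The single dislocation and the finite array -/

theorem dirac_compl_singleton : (Measure.dirac (0 : Plane)) {0}ᶜ = 0 := by
  simp

theorem potential_dirac (k : Fin 3) : potential (Measure.dirac 0) k = kernel k := by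
  funext x
  simp [potential]

/-- The segment carrying a finite array of dislocations. -/
def segment (Lm Lp : ℝ) : Set Plane := (fun s : ℝ => (!₂[s, 0] : Plane)) '' Set.Icc (-Lm) Lp

theorem continuous_axis : Continuous fun s : ℝ => (!₂[s, 0] : Plane) := by
  have : (fun s : ℝ => (!₂[s, 0] : Plane)) = fun s => s • EuclideanSpace.single 0 1 := by
    funext s
    ext i
    fin_cases i <;> simp
  rw [this]
  fun_prop

theorem norm_axis (s : ℝ) : ‖(!₂[s, 0] : Plane)‖ = |s| := by
  rw [EuclideanSpace.norm_eq]
  simp [Fin.sum_univ_two, Real.sqrt_sq_eq_abs]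

theorem isCompact_segment (Lm Lp : ℝ) : IsCompact (segment Lm Lp) :=
  isCompact_Icc.image continuous_axis

theorem segment_subset_axis {Lm Lp : ℝ} {ξ : Plane} (h : ξ ∈ segment Lm Lp) : ξ 1 = 0 := by
  obtain ⟨s, -, rfl⟩ := h
  simp

/-- The plastic field is identified with the potential only off the segment; being null, the segment
does not affect the distributions they define. -/
theorem volume_segment (Lm Lp : ℝ) : volume (segment Lm Lp) = 0 := by
  let ℓ : Plane →ₗ[ℝ] ℝ := (EuclideanSpace.proj (1 : Fin 2) : Plane →L[ℝ] ℝ).toLinearMap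
  have hne : LinearMap.ker ℓ ≠ ⊤ := fun h => by
    have : ℓ (EuclideanSpace.single 1 1) = 0 := by
      rw [LinearMap.ker_eq_top.1 h]
      rfl
    simp [ℓ] at this
  refine measure_mono_null (fun ξ hξ => ?_) (Measure.addHaar_submodule volume _ hne)
  exact segment_subset_axis hξ

theorem integral_arrayMeasure {Lm Lp : ℝ} (hm : 0 < Lm) (hp : 0 < Lp) {f : Plane → ℝ}
    (hf : Measurable f) :
    ∫ x, f x ∂(arrayMeasure Lm Lp) = (Lm + Lp)⁻¹ * ∫ s in (-Lm)..Lp, f !₂[s, 0] := by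
  unfold arrayMeasure
  rw [integral_smul_measure, integral_map continuous_axis.aemeasurable hf.aestronglyMeasurable,
    ENNReal.toReal_ofReal (by positivity), intervalIntegral.integral_of_le (by linarith),
    integral_Ioc_eq_integral_Ioo, smul_eq_mul, one_div]

theorem isProbabilityMeasure_arrayMeasure {Lm Lp : ℝ} (hm : 0 < Lm) (hp : 0 < Lp) :
    IsProbabilityMeasure (arrayMeasure Lm Lp) := by
  constructor
  unfold arrayMeasure
  rw [Measure.smul_apply, Measure.map_apply continuous_axis.measurable .univ]
  simp only [Set.preimage_univ, Measure.restrict_apply_univ, Real.volume_Ioo, smul_eq_mul]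
  rw [← ENNReal.ofReal_mul (by positivity), sub_neg_eq_add, add_comm Lp, one_div,
    inv_mul_cancel₀ (by positivity), ENNReal.ofReal_one]

theorem arrayMeasure_compl_segment (Lm Lp : ℝ) : arrayMeasure Lm Lp (segment Lm Lp)ᶜ = 0 := by
  unfold arrayMeasure
  rw [Measure.smul_apply, Measure.map_apply continuous_axis.measurable
    (isCompact_segment Lm Lp).measurableSet.compl, Measure.restrict_apply
    (continuous_axis.measurable (isCompact_segment Lm Lp).measurableSet.compl)]
  have : (fun s : ℝ => (!₂[s, 0] : Plane)) ⁻¹' (segment Lm Lp)ᶜ ∩ Set.Ioo (-Lm) Lp = ∅ := by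
    ext s
    simp only [Set.mem_inter_iff, Set.mem_preimage, Set.mem_compl_iff, Set.mem_empty_iff_false,
      iff_false, not_and]
    exact fun h hs => h ⟨s, Set.Ioo_subset_Icc_self hs, rfl⟩
  rw [this, measure_empty, smul_zero]

theorem tendsto_potential_arrayMeasure (k : Fin 3) {x : Plane} (hx : x ≠ 0) :
    Tendsto (fun L : ℝ × ℝ => potential (arrayMeasure L.1 L.2) k x)
      (𝓝[>] 0 ×ˢ 𝓝[>] 0) (𝓝 (kernel k x)) := by
  rw [Metric.tendsto_nhds]
  intro η hη
  have hcont : ContinuousAt (fun ξ => kernel k (x - ξ)) 0 := by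
    refine ContinuousAt.comp (g := kernel k) ?_ (by fun_prop)
    rw [sub_zero]
    exact (contDiffAt_kernel k hx).continuousAt
  obtain ⟨d, hd, hball⟩ := Metric.continuousAt_iff.1 hcont (η / 2) (by positivity)
  have hsmall : ∀ d : ℝ, 0 < d → ∀ᶠ t : ℝ in 𝓝[>] 0, 0 < t ∧ t < d := fun d hd =>
    (eventually_mem_nhdsWithin.and (eventually_nhdsWithin_of_eventually_nhds (gt_mem_nhds hd)))
  have hx' : 0 < ‖x‖ := norm_pos_iff.2 hx
  -- Staying below `d` uses the continuity of the kernel; staying below `‖x‖` keeps `x` off the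
  -- segment.
  have hmin : 0 < min d ‖x‖ := lt_min hd hx'
  filter_upwards [(hsmall _ hmin).prod_mk (hsmall _ hmin)] with L hL
  obtain ⟨⟨hm, hmd⟩, hp, hpd⟩ := hL
  have := isProbabilityMeasure_arrayMeasure hm hp
  have hn : ∀ ξ ∈ segment L.1 L.2, ‖ξ‖ < min d ‖x‖ := by
    rintro ξ ⟨s, hs, rfl⟩
    change ‖(!₂[s, 0] : Plane)‖ < _
    rw [norm_axis, abs_lt]
    exact ⟨by linarith [hs.1], hs.2.trans_lt hpd⟩
  have hxs : x ∉ segment L.1 L.2 := fun h =>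
    absurd (hn x h) (not_lt.2 (min_le_right _ _))
  have hint := integrable_kernel_sub (isCompact_segment _ _) (arrayMeasure_compl_segment L.1 L.2) k
    hxs
  have hconst : kernel k x = ∫ _ : Plane, kernel k x ∂(arrayMeasure L.1 L.2) := by simp
  rw [dist_eq_norm]
  unfold potential
  rw [hconst, ← integral_sub hint (integrable_const _)]
  have h2 := norm_integral_le_of_norm_le_const (μ := arrayMeasure L.1 L.2)
    (f := fun ξ => kernel k (x - ξ) - kernel k x) (C := η / 2) ?_
  · simp only [probReal_univ, mul_one] at h2
    linarith
  · filter_upwards [mem_ae_iff.2 (arrayMeasure_compl_segment L.1 L.2)] with ξ hξ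
    have h3 := hball (x := ξ) (by
      rw [dist_zero_right]
      exact (hn ξ hξ).trans_le (min_le_left _ _))
    rw [sub_zero, dist_eq_norm] at h3
    exact h3.le

theorem proj_ne_zero {p : EuclideanSpace ℝ (Fin 3)} (hp : p 0 ≠ 0 ∨ p 1 ≠ 0) : proj p ≠ 0 := by
  intro h
  have h1 : p 0 = 0 := congrArg (fun v : Plane => v 0) h
  have h2 : p 1 = 0 := congrArg (fun v : Plane => v 1) h
  tauto

theorem biotSavart_dirac (b : ℝ) {p : EuclideanSpace ℝ (Fin 3)} (hp : p 0 ≠ 0 ∨ p 1 ≠ 0) :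
    biotSavart b (Measure.dirac 0) p = fun k => b * kernel k (proj p) := by
  rw [biotSavart_eq_potential b isCompact_singleton dirac_compl_singleton (proj_ne_zero hp)]
  simp only [potential_dirac]

theorem tendsto_biotSavart_arrayMeasure (b : ℝ) {p : EuclideanSpace ℝ (Fin 3)}
    (hp : p 0 ≠ 0 ∨ p 1 ≠ 0) :
    Tendsto (fun L : ℝ × ℝ => biotSavart b (arrayMeasure L.1 L.2) p)
      (𝓝[>] 0 ×ˢ 𝓝[>] 0) (𝓝 (biotSavart b (Measure.dirac 0) p)) := by
  rw [biotSavart_dirac b hp, tendsto_pi_nhds]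
  intro k
  refine ((tendsto_potential_arrayMeasure k (proj_ne_zero hp)).const_mul b).congr' ?_
  have hx' : 0 < ‖proj p‖ := norm_pos_iff.2 (proj_ne_zero hp)
  have hsmall : ∀ᶠ t : ℝ in 𝓝[>] 0, 0 < t ∧ t < ‖proj p‖ :=
    (eventually_mem_nhdsWithin.and (eventually_nhdsWithin_of_eventually_nhds (gt_mem_nhds hx')))
  filter_upwards [hsmall.prod_mk hsmall] with L hL
  obtain ⟨⟨hm, hmd⟩, h0, hpd⟩ := hL
  have := isProbabilityMeasure_arrayMeasure hm h0
  have hxs : proj p ∉ segment L.1 L.2 := by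
    rintro ⟨s, hs, he⟩
    have : ‖proj p‖ = |s| := by rw [← he]; exact norm_axis s
    have : |s| < ‖proj p‖ := abs_lt.2 ⟨by linarith [hs.1], hs.2.trans_lt hpd⟩
    linarith
  rw [biotSavart_eq_potential b (isCompact_segment _ _) (arrayMeasure_compl_segment _ _) hxs]

/-! ### Distributions given by smooth functions -/

theorem SmoothOn.zero (U : Set Plane) : SmoothOn 0 U :=
  ⟨0, contDiffOn_const, fun φ _ => by simp⟩

theorem SmoothOn.integrable {f : Plane → ℝ} {U : Set Plane} (hf : ContinuousOn f U) {φ : Plane → ℝ}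
    (hφ : Continuous φ) (hc : HasCompactSupport φ) (hU : tsupport φ ⊆ U) :
    Integrable fun x => f x * φ x := by
  have h : IntegrableOn (fun x => f x * φ x) (tsupport φ) :=
    ((hf.mono hU).mul hφ.continuousOn).integrableOn_compact hc
  rwa [integrableOn_iff_integrable_of_support_subset] at h
  intro x hx
  exact subset_tsupport _ (right_ne_zero_of_mul hx)

theorem SmoothOn.const_smul {T : Dist} {U : Set Plane} (h : SmoothOn T U) (c : ℝ) :
    SmoothOn (c • T) U := by
  obtain ⟨f, hf, h⟩ := h
  refine ⟨fun x => c * f x, contDiffOn_const.mul hf, fun φ hφ => ?_⟩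
  change c * T φ = _
  simp_rw [mul_assoc]
  rw [h φ hφ, integral_const_mul]

theorem SmoothOn.add {S T : Dist} {U : Set Plane} (hS : SmoothOn S U) (hT : SmoothOn T U) :
    SmoothOn (S + T) U := by
  obtain ⟨f, hf, hS⟩ := hS
  obtain ⟨g, hg, hT⟩ := hT
  refine ⟨fun x => f x + g x, hf.add hg, fun φ hφ => ?_⟩
  change S φ + T φ = _
  simp_rw [add_mul]
  rw [hS φ hφ, hT φ hφ, integral_add
    (SmoothOn.integrable hf.continuousOn φ.continuous φ.hasCompactSupport hφ)
    (SmoothOn.integrable hg.continuousOn φ.continuous φ.hasCompactSupport hφ)]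

theorem SmoothOn.neg {T : Dist} {U : Set Plane} (h : SmoothOn T U) : SmoothOn (-T) U := by
  simpa using h.const_smul (-1)

theorem SmoothOn.sub {S T : Dist} {U : Set Plane} (hS : SmoothOn S U) (hT : SmoothOn T U) :
    SmoothOn (S - T) U := by
  rw [sub_eq_add_neg]
  exact hS.add hT.neg

theorem tsupport_lineDeriv_subset (φ : Test) (v : Plane) :
    tsupport (∂_{v} φ : Test) ⊆ tsupport φ := by
  refine closure_minimal (fun x hx => ?_) (isClosed_tsupport _)
  by_contra h
  apply hx
  rw [Test.lineDeriv_apply, fderiv_of_notMem_tsupport ℝ h]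
  rfl

/-- Integration by parts needs `f` differentiable only on the support of the test function, which
lies in `U`. -/
theorem SmoothOn.lineDeriv {T : Dist} {U : Set Plane} (hU : IsOpen U) (h : SmoothOn T U)
    (v : Plane) : SmoothOn (∂_{v} T) U := by
  obtain ⟨f, hf, h⟩ := h
  have hf' : ContDiffOn ℝ (⊤ : ℕ∞) (fun x => fderiv ℝ f x v) U :=
    (hf.fderiv_of_isOpen hU (by simp)).clm_apply contDiffOn_const
  refine ⟨_, hf', fun φ hφ => ?_⟩
  have hφ' := (tsupport_lineDeriv_subset φ v).trans hφ
  rw [Distribution.lineDerivOp_apply_apply, map_neg, h _ hφ']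
  have h1 := SmoothOn.integrable hf.continuousOn (∂_{v} φ : Test).continuous
    (∂_{v} φ : Test).hasCompactSupport hφ'
  simp only [Test.lineDeriv_apply] at h1 ⊢
  rw [integral_mul_fderiv_eq_neg_fderiv_mul_of_integrable
    (SmoothOn.integrable hf'.continuousOn φ.continuous φ.hasCompactSupport hφ) h1
    (SmoothOn.integrable hf.continuousOn φ.continuous φ.hasCompactSupport hφ)
    (fun x hx => (hf.contDiffAt (hU.mem_nhds (hφ hx))).differentiableAt (by simp))
    (fun x _ => (φ.contDiff.differentiable (by simp)) x), neg_neg]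

theorem SmoothOn.pderiv {T : Dist} {U : Set Plane} (hU : IsOpen U) (h : SmoothOn T U)
    (k : Fin 3) : SmoothOn (pderiv k T) U := by
  fin_cases k
  · exact h.lineDeriv hU _
  · exact h.lineDeriv hU _
  · exact SmoothOn.zero U

theorem SmoothOn.extDeriv {α : OneForm} {U : Set Plane} (hU : IsOpen U)
    (h : ∀ k, SmoothOn (α k) U) (k l : Fin 3) : SmoothOn (extDeriv α k l) U :=
  ((h l).pderiv hU k).sub ((h k).pderiv hU l)

theorem SmoothOn.ofFun {f : Plane → ℝ} (hf : LocallyIntegrable f) {U : Set Plane}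
    (h : ContDiffOn ℝ (⊤ : ℕ∞) f U) : SmoothOn (Volterra.ofFun f) U :=
  ⟨f, h, fun φ _ => ofFun_apply hf φ⟩

/-- The continuous density `f` of `T` satisfies `f q = 0` almost everywhere on `U`, and `q` may be
cancelled off a null set. Smoothness is essential here: a measure carried by the zeros of `q` is
also annihilated by `q`. -/
theorem SmoothOn.eq_zero_of_mul {T : Dist} {U : Set Plane} (hU : IsOpen U) (h : SmoothOn T U)
    {q : Plane → ℝ} (hq : ContDiffOn ℝ (⊤ : ℕ∞) q U) (hz : ∀ᵐ x, x ∈ U → q x ≠ 0)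
    (hT : ∀ φ : Test, tsupport φ ⊆ U → T (toTest fun x => q x * φ x) = 0) (φ : Test)
    (hφ : tsupport φ ⊆ U) : T φ = 0 := by
  obtain ⟨f, hf, h⟩ := h
  have hcont : ContinuousOn (fun x => f x * q x) U := hf.continuousOn.mul hq.continuousOn
  have hae := hU.ae_eq_zero_of_integral_contDiff_smul_eq_zero (μ := volume)
    (hcont.locallyIntegrableOn hU.measurableSet) fun g hg hgc hgU => by
      have hgq : ContDiff ℝ (⊤ : ℕ∞) fun x => q x * g x := by
        -- `q` is smooth only on `U`, so the product is glued with zero on the complement of the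
        -- support of `g`.
        rw [← contDiffOn_univ]
        have hsub : Set.univ ⊆ U ∪ (tsupport g)ᶜ := fun x _ => by
          by_cases hx : x ∈ tsupport g
          · exact .inl (hgU hx)
          · exact .inr hx
        refine ContDiffOn.mono ?_ hsub
        refine ContDiffOn.union_of_isOpen (hq.mul hg.contDiffOn) ?_ hU
          (isClosed_tsupport g).isOpen_compl
        refine (contDiffOn_const (c := (0 : ℝ))).congr fun x hx => ?_
        rw [image_eq_zero_of_notMem_tsupport hx, mul_zero]
      have hgqc : HasCompactSupport fun x => q x * g x := hgc.mul_left
      have h1 := hT (toTest g) (by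
        rwa [show ⇑(toTest g) = g from funext (toTest_apply hg hgc)])
      simp only [toTest_apply hg hgc] at h1
      have hsub : tsupport (toTest fun x => q x * g x) ⊆ U := by
        rw [show ⇑(toTest fun x => q x * g x) = fun x => q x * g x from
          funext (toTest_apply hgq hgqc)]
        exact (closure_mono (Function.support_mul_subset_right _ _)).trans hgU
      rw [h _ hsub] at h1
      rw [← h1]
      congr 1
      funext x
      rw [toTest_apply hgq hgqc, smul_eq_mul]
      ring
  rw [h φ hφ]
  apply integral_eq_zero_of_ae
  filter_upwards [hae, hz] with x hx hqx
  by_cases hxU : x ∈ U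
  · simp [(mul_eq_zero.1 (hx hxU)).resolve_right (hqx hxU)]
  · have : φ x = 0 := image_eq_zero_of_notMem_tsupport fun h => hxU (hφ h)
    simp [this]

/-! ### Existence of a Levi-Civita connection -/

/-- The connection whose only nonzero entries are `ω¹₂ = -ω²₁ = -T dy`. -/
def edgeConnection (T : Dist) : Connection :=
  fun i j => if i = 0 ∧ j = 1 then ![0, -T, 0] else if i = 1 ∧ j = 0 then ![0, T, 0] else 0

theorem edgeConnection_skew (T : Dist) (i j k : Fin 3) :
    edgeConnection T i j k = -edgeConnection T j i k := by
  fin_cases i <;> fin_cases j <;> fin_cases k <;> simp [edgeConnection]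

theorem coframe_eq {b : ℝ} {μ : Measure Plane} [IsFiniteMeasure μ] {K : Set Plane}
    (hK : IsCompact K) (hμ : μ Kᶜ = 0) (hv : volume K = 0) :
    coframe b μ = ![![ofFun fun _ => 1, 0, 0],
      ![b • ofFun (potential μ 0), (ofFun fun _ => 1) + b • ofFun (potential μ 1), 0],
      ![0, 0, ofFun fun _ => 1]] := by
  have h2 : ofFun (potential μ 2) = 0 := by
    have : potential μ 2 = fun _ => 0 := by
      funext x
      simp [potential]
    rw [this, ofFun_zero]
  funext i k
  unfold coframe
  simp only [ofFun_plasticField b hK hμ hv]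
  fin_cases i <;> fin_cases k <;> simp [h2]

theorem mollify_smul (ρ : Test) (ε : ℝ) (c : ℝ) (S : Dist) (x : Plane) :
    mollify ρ ε (c • S) x = c * mollify ρ ε S x := rfl

@[simp]
theorem pderiv_ofFun_one (k : Fin 3) : pderiv k (ofFun fun _ => 1) = 0 := by
  have h : ∀ v : Plane, ∂_{v} (ofFun fun _ => 1 : Dist) = 0 := fun v => by
    ext φ
    rw [Distribution.lineDerivOp_apply_apply, map_neg, ofFun_apply (locallyIntegrable_const 1)]
    have h := integral_mul_fderiv_eq_neg_fderiv_mul_of_integrable (μ := volume)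
      (f := fun _ : Plane => (1 : ℝ)) (g := φ) (v := v) (by simp)
      (by simpa [Test.lineDeriv_apply] using
        Test.integrable_mul (∂_{v} φ) (locallyIntegrable_const 1))
      (Test.integrable_mul φ (locallyIntegrable_const 1)) (by simp)
      (fun x _ => (φ.contDiff.differentiable (by simp)) x)
    simp only [Test.lineDeriv_apply]
    rw [h]
    simp
  fin_cases k
  · exact h _
  · exact h _
  · rfl

@[simp]
theorem pderiv_zero (k : Fin 3) : pderiv k 0 = 0 := by
  fin_cases k
  · exact map_zero (Distribution.lineDerivCLM (EuclideanSpace.single 0 1 : Plane))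
  · exact map_zero (Distribution.lineDerivCLM (EuclideanSpace.single 1 1 : Plane))
  · rfl

@[simp]
theorem pderiv_two (T : Dist) : pderiv 2 T = 0 := rfl

theorem pderiv_add (k : Fin 3) (S T : Dist) : pderiv k (S + T) = pderiv k S + pderiv k T := by
  fin_cases k
  · exact map_add (Distribution.lineDerivCLM (EuclideanSpace.single 0 1 : Plane)) S T
  · exact map_add (Distribution.lineDerivCLM (EuclideanSpace.single 1 1 : Plane)) S T
  · exact (add_zero (0 : Dist)).symm

theorem pderiv_smul (k : Fin 3) (c : ℝ) (T : Dist) : pderiv k (c • T) = c • pderiv k T := by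
  fin_cases k
  · exact map_smul (Distribution.lineDerivCLM (EuclideanSpace.single 0 1 : Plane)) c T
  · exact map_smul (Distribution.lineDerivCLM (EuclideanSpace.single 1 1 : Plane)) c T
  · exact (smul_zero c).symm

theorem pderiv_neg (k : Fin 3) (T : Dist) : pderiv k (-T) = -pderiv k T := by
  simpa using pderiv_smul k (-1) T

section Existence

variable {b : ℝ} {μ : Measure Plane} [IsFiniteMeasure μ] {K : Set Plane}

theorem extDeriv_coframe (hK : IsCompact K) (hμ : μ Kᶜ = 0) (hv : volume K = 0) (i : Fin 3) :
    extDeriv (coframe b μ i) = edgeTorsion (b • ofMeasure μ) i := by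
  rw [coframe_eq hK hμ hv]
  have h : pderiv 0 (ofFun (potential μ 1)) - pderiv 1 (ofFun (potential μ 0)) = ofMeasure μ :=
    curl_potential hK hμ
  funext k l
  fin_cases i <;> fin_cases k <;> fin_cases l <;>
    simp [extDeriv, edgeTorsion, dxdy, pderiv_add, pderiv_smul, ← h, smul_sub]

theorem isTorsion_zero (hK : IsCompact K) (hμ : μ Kᶜ = 0) (hv : volume K = 0) :
    IsTorsion (coframe b μ) 0 (edgeTorsion (b • ofMeasure μ)) := by
  intro ρ _ i k l φ
  simp [regWedge, extDeriv_coframe hK hμ hv]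

theorem isCurvature_zero : IsCurvature 0 0 := by
  intro ρ _ i j k l φ
  simp [regWedge, extDeriv]

/-- The regularised torsion is zero for each positive `ε`, not only in the limit. -/
theorem isLeviCivita_edgeConnection (hK : IsCompact K) (hμ : μ Kᶜ = 0) (hv : volume K = 0)
    (hK1 : ∀ ξ ∈ K, ξ 1 = 0) :
    IsLeviCivita (coframe b μ) (edgeConnection (b • ofMeasure μ)) where
  skew := edgeConnection_skew _
  torsion_free := by
    intro ρ hρ i k l φ
    refine tendsto_const_nhds.congr' ?_
    filter_upwards [self_mem_nhdsWithin] with ε (hε : 0 < ε)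
    have hae : ∀ᵐ ξ ∂μ, ξ 1 = 0 := by
      filter_upwards [mem_ae_iff.2 hμ] with ξ hξ using hK1 ξ hξ
    -- The only product of singular factors left in the torsion: `μ` lives on the axis, where the
    -- mollified factor vanishes by symmetry.
    have hp : regMul ρ ε (b • ofMeasure μ) (b • ofFun (potential μ 0)) φ = 0 := by
      change b * regMul ρ ε (ofMeasure μ) (b • ofFun (potential μ 0)) φ = 0
      rw [regMul_ofMeasure_eq_zero, mul_zero]
      filter_upwards [hae] with x hx
      rw [mollify_smul, mollify_potential_eq_zero hρ hε (locallyIntegrable_potential hK hμ 0) hae hx,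
        mul_zero]
    rw [extDeriv_coframe hK hμ hv, coframe_eq hK hμ hv]
    fin_cases i <;> fin_cases k <;> fin_cases l <;>
      simp [regWedge, edgeConnection, edgeTorsion, dxdy, Fin.sum_univ_three, regMul_neg_left, hp,
        regMul_one hρ hε]
  smooth := by
    intro U hU h i j k
    -- The connection coefficient is itself a coefficient of `dϑ²`, hence smooth wherever the
    -- coframe is.
    have hT : SmoothOn (b • ofMeasure μ) U := by
      have := SmoothOn.extDeriv hU (h 1) 0 1
      rwa [extDeriv_coframe hK hμ hv] at this
    fin_cases i <;> fin_cases j <;> fin_cases k <;>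
      simp [edgeConnection, SmoothOn.zero, hT, hT.neg]

end Existence

/-- All entries of the connection are multiples of `dy`, so the regularised quadratic terms cancel
identically even though `T · T` need not exist. -/
theorem isCurvature_edgeConnection (T : Dist) :
    IsCurvature (edgeConnection T) (wedgeCurvature (-(pderiv 0 T))) := by
  intro ρ _ i j k l φ
  refine tendsto_const_nhds.congr' (.of_forall fun ε => ?_)
  fin_cases i <;> fin_cases j <;> fin_cases k <;> fin_cases l <;>
    simp [regWedge, edgeConnection, wedgeCurvature, dxdy, extDeriv, Fin.sum_univ_three, pderiv_neg]

/-- Limits are unique once at least one radial mollifier is known to exist. -/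
theorem IsCurvature.unique {ω : Connection} {Ω Ω' : Curvature} (h : IsCurvature ω Ω)
    (h' : IsCurvature ω Ω') : Ω = Ω' := by
  obtain ⟨ρ, hρ, -⟩ := exists_annular_mollifier
  funext i j k l
  ext φ
  exact tendsto_nhds_unique (h ρ hρ i j k l φ) (h' ρ hρ i j k l φ)

/-! ### Uniqueness of the Levi-Civita connection of the single edge dislocation -/

theorem ofMeasure_dirac (x : Plane) : ofMeasure (Measure.dirac x) = Distribution.delta x := by
  ext φ
  rw [ofMeasure_apply, integral_dirac]
  rfl

theorem coframe_dirac (b : ℝ) :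
    coframe b (Measure.dirac 0) = ![![ofFun fun _ => 1, 0, 0],
      ![b • ofFun (kernel 0), (ofFun fun _ => 1) + b • ofFun (kernel 1), 0],
      ![0, 0, ofFun fun _ => 1]] := by
  rw [coframe_eq isCompact_singleton dirac_compl_singleton (by simp), potential_dirac,
    potential_dirac]

theorem extDeriv_coframe_dirac (b : ℝ) (i : Fin 3) :
    extDeriv (coframe b (Measure.dirac 0) i) = edgeTorsion (b • Distribution.delta 0) i := by
  rw [extDeriv_coframe isCompact_singleton dirac_compl_singleton (by simp), ofMeasure_dirac]

theorem contDiffOn_kernel (k : Fin 3) : ContDiffOn ℝ (⊤ : ℕ∞) (kernel k) {0}ᶜ := fun _ hx =>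
  (contDiffAt_kernel k hx).contDiffWithinAt

theorem smoothOn_coframe_dirac (b : ℝ) (i k : Fin 3) :
    SmoothOn (coframe b (Measure.dirac 0) i k) {0}ᶜ := by
  have h1 : SmoothOn (ofFun fun _ => 1) {0}ᶜ :=
    SmoothOn.ofFun (locallyIntegrable_const 1) contDiffOn_const
  have hk : ∀ k, SmoothOn (b • ofFun (kernel k)) {0}ᶜ := fun k =>
    (SmoothOn.ofFun (locallyIntegrable_kernel k) (contDiffOn_kernel k)).const_smul b
  rw [coframe_dirac]
  fin_cases i <;> fin_cases k <;> simp [SmoothOn.zero, h1, hk, h1.add (hk 1)]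

theorem IsLeviCivita.diag {ϑ : Coframe} {ω : Connection} (h : IsLeviCivita ϑ ω) (i : Fin 3) :
    ω i i = 0 := by
  funext k
  ext φ
  have := congrArg (fun T : Dist => T φ) (h.skew i i k)
  change ω i i k φ = -ω i i k φ at this
  change ω i i k φ = 0
  linarith

/-- The torsion equations of a connection with entries `a = ω¹₂`, `β = ω¹₃`, `γ = ω²₃`, tested
with `φ`, where products with `Θ²ₓ` and `1 + Θ²_y` amount to replacing `φ` by `p` and `q`. -/
structure TorsionEquations (a β γ : OneForm) (D : Dist) (φ p q : Test) : Prop where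
  xy₁ : a 0 q - a 1 p = 0
  xz₁ : -a 2 p + β 0 φ = 0
  yz₁ : -a 2 q + β 1 φ = 0
  xy₂ : D φ + a 1 φ = 0
  xz₂ : a 2 φ + γ 0 φ = 0
  yz₂ : γ 1 φ = 0
  xy₃ : β 1 φ - γ 0 q + γ 1 p = 0
  xz₃ : β 2 φ + γ 2 p = 0
  yz₃ : γ 2 q = 0

/-- The torsion equations determine the connection wherever multiplication by `1 + Θ²_y` is
injective. -/
theorem TorsionEquations.solve {a β γ : OneForm} {D : Dist} {A : Set Test} {p q : Test → Test}
    (h : ∀ φ ∈ A, TorsionEquations a β γ D φ (p φ) (q φ)) (hp : ∀ φ ∈ A, p φ ∈ A)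
    (hq : ∀ φ ∈ A, q φ ∈ A) (hD : ∀ φ ∈ A, a 1 (p φ) = 0)
    (ha : ∀ k, (∀ φ ∈ A, a k (q φ) = 0) → ∀ φ ∈ A, a k φ = 0)
    (hγ : ∀ k, (∀ φ ∈ A, γ k (q φ) = 0) → ∀ φ ∈ A, γ k φ = 0) {φ : Test} (hφ : φ ∈ A) :
    (a 0 φ = 0 ∧ a 1 φ = -D φ ∧ a 2 φ = 0) ∧ (∀ k, β k φ = 0) ∧ ∀ k, γ k φ = 0 := by
  have ha0 : ∀ φ ∈ A, a 0 φ = 0 := ha 0 fun φ hφ => by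
    linarith [(h φ hφ).xy₁, hD φ hφ]
  -- Substituting the other equations into `xy₃` gives `2 a₂ (q φ) = 0`.
  have ha2 : ∀ φ ∈ A, a 2 φ = 0 := ha 2 fun φ hφ => by
    linarith [(h φ hφ).xy₃, (h φ hφ).yz₁, (h _ (hq φ hφ)).xz₂, (h _ (hp φ hφ)).yz₂]
  have hγ2 : ∀ φ ∈ A, γ 2 φ = 0 := hγ 2 fun φ hφ => (h φ hφ).yz₃
  have e := h φ hφ
  have h1 := ha2 _ (hp φ hφ)
  have h2 := ha2 _ (hq φ hφ)
  have h3 := hγ2 _ (hp φ hφ)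
  have h4 := ha2 φ hφ
  refine ⟨⟨ha0 φ hφ, by linarith [e.xy₂], h4⟩, ?_, ?_⟩ <;> intro k <;> fin_cases k
  · change β 0 φ = 0
    linarith [e.xz₁]
  · change β 1 φ = 0
    linarith [e.yz₁]
  · change β 2 φ = 0
    linarith [e.xz₃]
  · change γ 0 φ = 0
    linarith [e.xz₂]
  · exact e.yz₂
  · exact hγ2 φ hφ

/-- Once the products are eventually constant in `ε`, so is every regularised torsion coefficient,
and its limit `0` is its value. Leaving `p` and `q` free lets the same computation serve both off
the origin and at it. -/
theorem IsLeviCivita.torsionEquations {b : ℝ} {ω : Connection}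
    (h : IsLeviCivita (coframe b (Measure.dirac 0)) ω) {ρ : Test} (hρ : IsRadialMollifier ρ)
    {φ p q : Test}
    (hp : ∀ i j k, ∀ᶠ ε in 𝓝[>] (0 : ℝ),
      regMul ρ ε (ω i j k) (b • ofFun (kernel 0)) φ = ω i j k p)
    (hq : ∀ i j k, ∀ᶠ ε in 𝓝[>] (0 : ℝ),
      regMul ρ ε (ω i j k) ((ofFun fun _ => 1) + b • ofFun (kernel 1)) φ = ω i j k q) :
    TorsionEquations (ω 0 1) (ω 0 2) (ω 1 2) (b • Distribution.delta 0) φ p q := by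
  have h10 : ω 1 0 = -ω 0 1 := funext fun k => h.skew 1 0 k
  have h20 : ω 2 0 = -ω 0 2 := funext fun k => h.skew 2 0 k
  have h21 : ω 2 1 = -ω 1 2 := funext fun k => h.skew 2 1 k
  have key : ∀ (i k l : Fin 3) (c : ℝ), (∀ᶠ ε in 𝓝[>] (0 : ℝ),
      extDeriv (coframe b (Measure.dirac 0) i) k l φ +
        ∑ j, regWedge ρ ε (ω i j) (coframe b (Measure.dirac 0) j) k l φ = c) → c = 0 :=
    fun i k l c hc => tendsto_nhds_unique (tendsto_const_nhds.congr' (hc.mono fun _ h => h.symm))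
      (h.torsion_free ρ hρ i k l φ)
  simp only [extDeriv_coframe_dirac] at key
  simp only [coframe_dirac] at key
  have hε : ∀ᶠ ε in 𝓝[>] (0 : ℝ), 0 < ε := self_mem_nhdsWithin
  constructor
  · refine key 0 0 1 _ ?_
    filter_upwards [hε, hp 0 1 1, hq 0 1 0] with ε hε hp hq
    simp [regWedge, edgeTorsion, Fin.sum_univ_three, h.diag, hp, hq]
  · refine key 0 0 2 _ ?_
    filter_upwards [hε, hp 0 1 2] with ε hε hp
    simp [regWedge, edgeTorsion, Fin.sum_univ_three, h.diag, hp, regMul_one hρ hε]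
    ring
  · refine key 0 1 2 _ ?_
    filter_upwards [hε, hq 0 1 2] with ε hε hq
    simp [regWedge, edgeTorsion, Fin.sum_univ_three, h.diag, hq, regMul_one hρ hε]
    ring
  · refine key 1 0 1 _ ?_
    filter_upwards [hε] with ε hε
    simp [regWedge, edgeTorsion, dxdy, Fin.sum_univ_three, h.diag, h10,
      regMul_one hρ hε]
  · refine key 1 0 2 _ ?_
    filter_upwards [hε] with ε hε
    simp [regWedge, edgeTorsion, dxdy, Fin.sum_univ_three, h.diag, h10,
      regMul_one hρ hε]
    ring
  · refine key 1 1 2 _ ?_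
    filter_upwards [hε] with ε hε
    simp [regWedge, edgeTorsion, dxdy, Fin.sum_univ_three, h.diag, h10, regMul_one hρ hε]
  · refine key 2 0 1 _ ?_
    filter_upwards [hε, hp 1 2 1, hq 1 2 0] with ε hε hp hq
    simp [regWedge, edgeTorsion, Fin.sum_univ_three, h.diag, h20, h21, regMul_neg_left, hp, hq,
      regMul_one hρ hε]
    ring
  · refine key 2 0 2 _ ?_
    filter_upwards [hε, hp 1 2 2] with ε hε hp
    simp [regWedge, edgeTorsion, Fin.sum_univ_three, h.diag, h20, h21, regMul_neg_left, hp,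
      regMul_one hρ hε]
    ring
  · refine key 2 1 2 _ ?_
    filter_upwards [hε, hq 1 2 2] with ε hε hq
    simp [regWedge, edgeTorsion, Fin.sum_univ_three, h.diag, h20, h21, regMul_neg_left, hq]

/-! ### Localisation at the origin -/

/-- Test functions supported off the origin. -/
def offOrigin : Set Test := {φ | tsupport φ ⊆ {0}ᶜ}

theorem mem_offOrigin_of_ball {φ : Test} {r : ℝ} (hr : 0 < r) (h : ∀ x, ‖x‖ < r → φ x = 0) :
    φ ∈ offOrigin := by
  intro x hx hx0
  rw [Set.mem_singleton_iff.1 hx0] at hx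
  refine notMem_tsupport_iff_eventuallyEq.2 ?_ hx
  filter_upwards [Metric.ball_mem_nhds (0 : Plane) hr] with y hy
  simpa using h y (by simpa using hy)

theorem exists_ball_of_mem_offOrigin {φ : Test} (h : φ ∈ offOrigin) :
    ∃ r, 0 < r ∧ ∀ x, ‖x‖ < r → φ x = 0 := by
  have h0 : (0 : Plane) ∈ (tsupport φ)ᶜ := fun hx => h hx rfl
  obtain ⟨r, hr, hb⟩ := Metric.isOpen_iff.1 (isClosed_tsupport φ).isOpen_compl 0 h0
  exact ⟨r, hr, fun x hx => image_eq_zero_of_notMem_tsupport (hb (by simpa using hx))⟩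

theorem contDiff_mul_of_mem_offOrigin {f : Plane → ℝ} (hf : ContDiffOn ℝ (⊤ : ℕ∞) f {0}ᶜ)
    {φ : Test} (h : φ ∈ offOrigin) : ContDiff ℝ (⊤ : ℕ∞) fun x => f x * φ x := by
  obtain ⟨r, hr, hb⟩ := exists_ball_of_mem_offOrigin h
  rw [contDiff_iff_contDiffAt]
  intro x
  by_cases hx : x = 0
  · refine (contDiffAt_const (c := (0 : ℝ))).congr_of_eventuallyEq ?_
    rw [hx]
    filter_upwards [Metric.ball_mem_nhds (0 : Plane) hr] with y hy
    rw [hb y (by simpa using hy), mul_zero]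
  · exact (hf.contDiffAt (isOpen_compl_singleton.mem_nhds hx)).mul φ.contDiff.contDiffAt

theorem toTest_mul_apply_of_mem_offOrigin {f : Plane → ℝ} (hf : ContDiffOn ℝ (⊤ : ℕ∞) f {0}ᶜ)
    {φ : Test} (h : φ ∈ offOrigin) (x : Plane) : toTest (fun x => f x * φ x) x = f x * φ x :=
  toTest_apply (contDiff_mul_of_mem_offOrigin hf h) φ.hasCompactSupport.mul_left x

theorem toTest_mul_mem_offOrigin {f : Plane → ℝ} (hf : ContDiffOn ℝ (⊤ : ℕ∞) f {0}ᶜ)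
    {φ : Test} (h : φ ∈ offOrigin) : toTest (fun x => f x * φ x) ∈ offOrigin := by
  obtain ⟨r, hr, hb⟩ := exists_ball_of_mem_offOrigin h
  exact mem_offOrigin_of_ball hr fun x hx => by
    rw [toTest_mul_apply_of_mem_offOrigin hf h, hb x hx, mul_zero]

/-- Regularised products agree with pointwise ones away from the singularity. -/
theorem regMul_eventually_eq_of_mem_offOrigin {ρ : Test} {S : Dist} {f : Plane → ℝ}
    (hS : ∀ ε x, 0 < ε → 2 * ε < ‖x‖ → mollify ρ ε S x = f x) (T : Dist) {φ : Test}
    (h : φ ∈ offOrigin) :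
    ∀ᶠ ε in 𝓝[>] (0 : ℝ), regMul ρ ε T S φ = T (toTest fun x => f x * φ x) := by
  obtain ⟨r, hr, hb⟩ := exists_ball_of_mem_offOrigin h
  filter_upwards [self_mem_nhdsWithin,
    eventually_nhdsWithin_of_eventually_nhds (gt_mem_nhds (half_pos hr))] with ε (hε : 0 < ε) hεr
  unfold regMul
  congr 2
  funext x
  by_cases hx : ‖x‖ < r
  · rw [hb x hx, mul_zero, mul_zero]
  · rw [hS ε x hε (by linarith)]

/-- Regularised products of distributions carried by the origin with a factor whose
regularisations are constant near the origin. -/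
theorem regMul_eventually_eq_of_support {ρ : Test} {S : Dist} {c : ℝ}
    (hsm : ∀ ε, 0 < ε → ContDiff ℝ (⊤ : ℕ∞) (mollify ρ ε S))
    (hS : ∀ ε x, 0 < ε → ‖x‖ < ε → mollify ρ ε S x = c) {T : Dist}
    (hT : ∀ φ ∈ offOrigin, T φ = 0) (φ : Test) :
    ∀ᶠ ε in 𝓝[>] (0 : ℝ), regMul ρ ε T S φ = T (c • φ) := by
  filter_upwards [self_mem_nhdsWithin] with ε (hε : 0 < ε)
  unfold regMul
  rw [← sub_eq_zero, ← map_sub]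
  refine hT _ (mem_offOrigin_of_ball hε fun x hx => ?_)
  have h1 : toTest (fun x => mollify ρ ε S x * φ x) x = mollify ρ ε S x * φ x :=
    toTest_apply ((hsm ε hε).mul φ.contDiff) φ.hasCompactSupport.mul_left x
  change toTest (fun x => mollify ρ ε S x * φ x) x - c * φ x = 0
  rw [h1, hS ε x hε hx, sub_self]

theorem ae_one_add_kernel_ne_zero (b : ℝ) :
    ∀ᵐ x : Plane, x ∈ ({0}ᶜ : Set Plane) → 1 + b * kernel 1 x ≠ 0 := by
  set c : ℝ := b * (2 * Real.pi)⁻¹ with hc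
  -- Clearing denominators in `1 + b * kernel 1 x = 0` gives `x₀² + x₁² + c x₀ = 0`, a circle
  -- through the origin, degenerate when `b = 0`.
  have hnull : volume (Metric.sphere (!₂[-(c / 2), 0] : Plane) (|c / 2|)) = 0 :=
    Measure.addHaar_sphere _ _ _
  filter_upwards [compl_mem_ae_iff.2 hnull] with x hx hx0 h
  apply hx
  rw [kernel_one_apply] at h
  have hpos : x 0 ^ 2 + x 1 ^ 2 ≠ 0 := by
    have : ‖x‖ ≠ 0 := norm_ne_zero_iff.2 hx0
    rw [← Fin.sum_univ_two (fun i => x i ^ 2), ← EuclideanSpace.real_norm_sq_eq]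
    positivity
  have h2 : x 0 ^ 2 + x 1 ^ 2 + c * x 0 = 0 := by
    have h3 : (1 + b * ((2 * Real.pi)⁻¹ * (x 0 / (x 0 ^ 2 + x 1 ^ 2)))) * (x 0 ^ 2 + x 1 ^ 2) =
        x 0 ^ 2 + x 1 ^ 2 + c * x 0 := by
      rw [hc]
      field_simp
    rw [← h3, h, zero_mul]
  rw [mem_sphere_iff_norm, ← sq_eq_sq₀ (norm_nonneg _) (abs_nonneg _),
    EuclideanSpace.real_norm_sq_eq, Fin.sum_univ_two, sq_abs]
  simp
  linear_combination h2

theorem IsLeviCivita.eq_edgeConnection {b : ℝ} {ω : Connection}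
    (h : IsLeviCivita (coframe b (Measure.dirac 0)) ω) :
    ω = edgeConnection (b • Distribution.delta 0) := by
  obtain ⟨ρ, hρ, hann⟩ := exists_annular_mollifier
  have hU : IsOpen ({0}ᶜ : Set Plane) := isOpen_compl_singleton
  have hsmooth := h.smooth _ hU (smoothOn_coframe_dirac b)
  have hp0 : ContDiffOn ℝ (⊤ : ℕ∞) (fun x => b * kernel 0 x) {0}ᶜ :=
    contDiffOn_const.mul (contDiffOn_kernel 0)
  have hq0 : ContDiffOn ℝ (⊤ : ℕ∞) (fun x => 1 + b * kernel 1 x) {0}ᶜ :=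
    contDiffOn_const.add (contDiffOn_const.mul (contDiffOn_kernel 1))
  have hδ : ∀ φ ∈ offOrigin, (b • Distribution.delta 0 : Dist) φ = 0 := fun φ hφ => by
    obtain ⟨r, hr, hb⟩ := exists_ball_of_mem_offOrigin hφ
    change b * φ 0 = 0
    rw [hb 0 (by simpa using hr), mul_zero]
  -- First pass: off the origin the regularised products are honest multiplications by the smooth
  -- functions `p` and `q`.
  have eqs : ∀ φ ∈ offOrigin, TorsionEquations (ω 0 1) (ω 0 2) (ω 1 2) (b • Distribution.delta 0) φ
      (toTest fun x => b * kernel 0 x * φ x) (toTest fun x => (1 + b * kernel 1 x) * φ x) := by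
    intro φ hφ
    refine h.torsionEquations hρ
      (fun i j k => regMul_eventually_eq_of_mem_offOrigin (fun ε x hε hx => ?_) _ hφ)
      (fun i j k => regMul_eventually_eq_of_mem_offOrigin (fun ε x hε hx => ?_) _ hφ)
    · rw [mollify_smul, mollify_kernel_of_lt_norm hρ hann hε hx]
    · rw [mollify_add, mollify_smul, mollify_one hρ hε, mollify_kernel_of_lt_norm hρ hann hε hx]
  -- Here the smoothness clause of `IsLeviCivita` enters: it excludes connections concentrated on
  -- the circle where `q` vanishes.
  have hcancel : ∀ i j k,
      (∀ φ ∈ offOrigin, ω i j k (toTest fun x => (1 + b * kernel 1 x) * φ x) = 0) →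
      ∀ φ ∈ offOrigin, ω i j k φ = 0 := fun i j k hz φ hφ =>
    (hsmooth i j k).eq_zero_of_mul hU hq0 (ae_one_add_kernel_ne_zero b) hz φ hφ
  have off := fun φ (hφ : φ ∈ offOrigin) => TorsionEquations.solve eqs
    (fun φ hφ => toTest_mul_mem_offOrigin hp0 hφ) (fun φ hφ => toTest_mul_mem_offOrigin hq0 hφ)
    (fun φ hφ => by
      have hm := toTest_mul_mem_offOrigin hp0 hφ
      have := (eqs _ hm).xy₂
      rwa [hδ _ hm, zero_add] at this)
    (hcancel 0 1) (hcancel 1 2) hφ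
  have hsupp : ∀ i j k, ∀ φ ∈ offOrigin, ω i j k φ = 0 := by
    have h01 : ∀ k, ∀ φ ∈ offOrigin, ω 0 1 k φ = 0 := fun k φ hφ => by
      have h1 := (off φ hφ).1.2.1
      rw [hδ φ hφ, neg_zero] at h1
      fin_cases k
      · exact (off φ hφ).1.1
      · exact h1
      · exact (off φ hφ).1.2.2
    have hneg : ∀ i j k, (∀ φ ∈ offOrigin, ω i j k φ = 0) → ∀ φ ∈ offOrigin, ω j i k φ = 0 :=
      fun i j k hz φ hφ => by
        rw [h.skew j i k]
        change -ω i j k φ = 0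
        rw [hz φ hφ, neg_zero]
    have h02 : ∀ k, ∀ φ ∈ offOrigin, ω 0 2 k φ = 0 := fun k φ hφ => (off φ hφ).2.1 k
    have h12 : ∀ k, ∀ φ ∈ offOrigin, ω 1 2 k φ = 0 := fun k φ hφ => (off φ hφ).2.2 k
    have hdiag : ∀ i k, ∀ φ ∈ offOrigin, ω i i k φ = 0 := fun i k φ _ => by
      rw [h.diag i]
      rfl
    intro i j k
    fin_cases i <;> fin_cases j
    exacts [hdiag 0 k, h01 k, h02 k, hneg 0 1 k (h01 k), hdiag 1 k, h12 k, hneg 0 2 k (h02 k),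
      hneg 1 2 k (h12 k), hdiag 2 k]
  -- Second pass: `ω` is now carried by the origin, near which the mollified `p` and `q` are exactly
  -- `0` and `1`. The equations thus hold for all test functions.
  have eqs' : ∀ φ ∈ (Set.univ : Set Test), TorsionEquations (ω 0 1) (ω 0 2) (ω 1 2)
      (b • Distribution.delta 0) φ ((0 : ℝ) • φ) ((1 : ℝ) • φ) := by
    intro φ _
    have hk := fun (ε : ℝ) (hε : 0 < ε) k =>
      contDiff_mollify_ofFun ρ hε (locallyIntegrable_kernel k)
    refine h.torsionEquations hρ
      (fun i j k => regMul_eventually_eq_of_support (fun ε hε => ?_) (fun ε x hε hx => ?_)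
        (hsupp i j k) φ)
      (fun i j k => regMul_eventually_eq_of_support (fun ε hε => ?_) (fun ε x hε hx => ?_)
        (hsupp i j k) φ)
    · exact contDiff_const.mul (hk ε hε 0)
    · rw [mollify_smul, mollify_kernel_of_norm_lt hρ hann hε hx, mul_zero]
    · exact (contDiff_mollify_ofFun ρ hε (locallyIntegrable_const 1)).add
        (contDiff_const.mul (hk ε hε 1))
    · rw [mollify_add, mollify_smul, mollify_one hρ hε, mollify_kernel_of_norm_lt hρ hann hε hx,
        mul_zero, add_zero]
  have hall := fun φ => TorsionEquations.solve (p := fun φ => (0 : ℝ) • φ)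
    (q := fun φ => (1 : ℝ) • φ) eqs' (fun _ _ => trivial) (fun _ _ => trivial)
    (fun φ _ => by simp) (fun k hk φ hφ => by simpa using hk φ hφ)
    (fun k hk φ hφ => by simpa using hk φ hφ) (Set.mem_univ φ)
  have h01 : ω 0 1 = ![0, -(b • Distribution.delta 0), 0] := by
    funext k
    ext φ
    fin_cases k
    · exact (hall φ).1.1
    · exact (hall φ).1.2.1
    · exact (hall φ).1.2.2
  have h02 : ω 0 2 = 0 := funext fun k => ContinuousLinearMap.ext fun φ => (hall φ).2.1 k
  have h12 : ω 1 2 = 0 := funext fun k => ContinuousLinearMap.ext fun φ => (hall φ).2.2 k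
  have h10 : ω 1 0 = -ω 0 1 := funext fun k => h.skew 1 0 k
  have h20 : ω 2 0 = -ω 0 2 := funext fun k => h.skew 2 0 k
  have h21 : ω 2 1 = -ω 1 2 := funext fun k => h.skew 2 1 k
  funext i j
  fin_cases i <;> fin_cases j <;> simp [edgeConnection, h.diag, h01, h02, h12, h10, h20, h21]

/-! ### The point dipole -/

/-- The curvature coefficient of the single edge dislocation. -/
def dipole (b : ℝ) : Dist :=
  -(b • ∂_{(EuclideanSpace.single 0 1 : Plane)} (Distribution.delta 0 : Dist))

theorem dipole_apply (b : ℝ) (φ : Test) :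
    dipole b φ = b * fderiv ℝ φ 0 (EuclideanSpace.single 0 1) := by
  change -(b * (∂_{(EuclideanSpace.single 0 1 : Plane)} (Distribution.delta 0 : Dist)) φ) = _
  rw [Distribution.lineDerivOp_apply_apply, map_neg, Distribution.delta_apply,
    Test.lineDeriv_apply]
  ring

theorem wedgeCurvature_apply_eq (T : Dist) : wedgeCurvature T 0 1 0 1 = T := by
  simp [wedgeCurvature, dxdy]

theorem dipole_apply_of_notMem_tsupport (b : ℝ) {φ : Test} (h : (0 : Plane) ∉ tsupport φ) :
    dipole b φ = 0 := by
  rw [dipole_apply, fderiv_of_notMem_tsupport ℝ h]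
  simp

theorem hasPairing_dipole (b : ℝ) (f : Plane → ℝ) :
    HasPairing (dipole b) f (b * fderiv ℝ f 0 (EuclideanSpace.single 0 1)) := by
  refine ⟨{0}, isCompact_singleton, fun φ h => ?_, fun φ h => ?_⟩
  · exact dipole_apply_of_notMem_tsupport b (Set.disjoint_singleton_right.1 h)
  · rw [nhdsSet_singleton] at h
    rw [dipole_apply, Filter.EventuallyEq.fderiv_eq h]

theorem fderiv_coordinate (m : Fin 2) (x v : Plane) :
    fderiv ℝ (fun x : Plane => x m) x v = v m := by
  have h : HasFDerivAt (fun x : Plane => x m) (EuclideanSpace.proj m : Plane →L[ℝ] ℝ) x :=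
    (EuclideanSpace.proj m : Plane →L[ℝ] ℝ).hasFDerivAt
  rw [h.fderiv]
  rfl

/-! ### The finite dipole -/

theorem hasDerivAt_axis (φ : Test) (s : ℝ) :
    HasDerivAt (fun s : ℝ => φ !₂[s, 0])
      (fderiv ℝ φ !₂[s, 0] (EuclideanSpace.single 0 1)) s := by
  have h1 : HasFDerivAt φ (fderiv ℝ φ !₂[s, 0]) !₂[s, 0] :=
    ((φ.contDiff.differentiable (by simp)) _).hasFDerivAt
  have he : (fun s : ℝ => (!₂[s, 0] : Plane)) = fun s => s • EuclideanSpace.single 0 1 := by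
    funext s
    ext i
    fin_cases i <;> simp
  have h2 : HasDerivAt (fun s : ℝ => (!₂[s, 0] : Plane)) (EuclideanSpace.single 0 1) s := by
    rw [he]
    simpa using (hasDerivAt_id s).smul_const (EuclideanSpace.single 0 1 : Plane)
  exact h1.comp_hasDerivAt s h2

theorem finiteDipole_apply (c : ℝ) (p q : Plane) (φ : Test) :
    (c • (Distribution.delta p - Distribution.delta q) : Dist) φ = c * (φ p - φ q) := rfl

/-- The derivative of a uniform density on a segment is concentrated at its ends: on test functions
this is the fundamental theorem of calculus along the axis. -/
theorem neg_pderiv_arrayMeasure (b : ℝ) {Lm Lp : ℝ} (hm : 0 < Lm) (hp : 0 < Lp) :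
    -(pderiv 0 (b • ofMeasure (arrayMeasure Lm Lp))) =
      (b / (Lm + Lp)) • (Distribution.delta !₂[Lp, 0] - Distribution.delta !₂[-Lm, 0]) := by
  have := isProbabilityMeasure_arrayMeasure hm hp
  ext φ
  rw [finiteDipole_apply, pderiv_smul]
  change -(b * (∂_{(EuclideanSpace.single 0 1 : Plane)} (ofMeasure (arrayMeasure Lm Lp))) φ) = _
  have hc : Continuous fun x => fderiv ℝ φ x (EuclideanSpace.single 0 1) :=
    (continuous_fderiv φ).clm_apply continuous_const
  rw [Distribution.lineDerivOp_apply_apply, map_neg, ofMeasure_apply]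
  simp only [Test.lineDeriv_apply]
  rw [integral_arrayMeasure hm hp hc.measurable,
    intervalIntegral.integral_eq_sub_of_hasDerivAt (fun s _ => hasDerivAt_axis φ s)
      ((hc.comp continuous_axis).intervalIntegrable _ _)]
  ring

theorem hasPairing_finiteDipole (c : ℝ) (p q : Plane) (f : Plane → ℝ) :
    HasPairing (c • (Distribution.delta p - Distribution.delta q)) f (c * (f p - f q)) := by
  refine ⟨{p, q}, (Set.toFinite _).isCompact, fun φ h => ?_, fun φ h => ?_⟩
  · have hp : φ p = 0 := image_eq_zero_of_notMem_tsupport fun hx =>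
      Set.disjoint_left.1 h hx (by simp)
    have hq : φ q = 0 := image_eq_zero_of_notMem_tsupport fun hx =>
      Set.disjoint_left.1 h hx (by simp)
    rw [finiteDipole_apply, hp, hq, sub_zero, mul_zero]
  · have h' := h.self_of_nhdsSet
    rw [finiteDipole_apply, h' p (by simp), h' q (by simp)]

theorem isWedgeDipole_arrayMeasure (b : ℝ) {Lm Lp : ℝ} (hm : 0 < Lm) (hp : 0 < Lp) :
    IsWedgeDipole (coframe b (arrayMeasure Lm Lp)) (b / (Lm + Lp)) !₂[Lp, 0] !₂[-Lm, 0] := by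
  have := isProbabilityMeasure_arrayMeasure hm hp
  refine ⟨_, _, isLeviCivita_edgeConnection (isCompact_segment Lm Lp)
    (arrayMeasure_compl_segment Lm Lp) (volume_segment Lm Lp) fun _ => segment_subset_axis,
    isCurvature_edgeConnection _, ?_⟩
  rw [neg_pderiv_arrayMeasure b hm hp]

theorem tendsto_finiteDipole (b : ℝ) (φ : Test) :
    Tendsto (fun L : ℝ × ℝ => ((b / (L.1 + L.2)) •
      (Distribution.delta !₂[L.2, 0] - Distribution.delta !₂[-L.1, 0] : Dist)) φ)
      (𝓝[>] 0 ×ˢ 𝓝[>] 0) (𝓝 (dipole b φ)) := by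
  have hsm : ContDiff ℝ 1 fun s : ℝ => φ !₂[s, 0] := by
    refine (φ.contDiff.of_le (by simp)).comp ?_
    rw [contDiff_euclidean]
    intro i
    fin_cases i
    · exact contDiff_id
    · exact contDiff_const
  have h0 : (!₂[0, 0] : Plane) = 0 := by
    ext i
    fin_cases i <;> rfl
  -- Both endpoints move independently, so the difference quotient converges by strict
  -- differentiability at `0`; a plain derivative would not give this directly.
  have hd : HasStrictDerivAt (fun s : ℝ => φ !₂[s, 0])
      (fderiv ℝ φ 0 (EuclideanSpace.single 0 1)) 0 := by
    have := (hsm.contDiffAt (x := 0)).hasStrictDerivAt' (hasDerivAt_axis φ 0) (by simp)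
    rwa [h0] at this
  have hL : Tendsto (fun L : ℝ × ℝ => (L.2, -L.1)) (𝓝[>] 0 ×ˢ 𝓝[>] 0) (𝓝 (0, 0)) := by
    have h1 : Tendsto (fun L : ℝ × ℝ => L.1) (𝓝[>] 0 ×ˢ 𝓝[>] 0) (𝓝 0) :=
      tendsto_fst.mono_right nhdsWithin_le_nhds
    have h2 : Tendsto (fun L : ℝ × ℝ => L.2) (𝓝[>] 0 ×ˢ 𝓝[>] 0) (𝓝 0) :=
      tendsto_snd.mono_right nhdsWithin_le_nhds
    rw [nhds_prod_eq]
    exact h2.prodMk (by simpa using h1.neg)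
  have hlim := (hd.isLittleO.comp_tendsto hL).tendsto_div_nhds_zero
  rw [dipole_apply]
  have hfin := (hlim.add_const (fderiv ℝ φ 0 (EuclideanSpace.single 0 1))).const_mul b
  rw [zero_add] at hfin
  refine hfin.congr' ?_
  have hpos : ∀ᶠ t : ℝ in 𝓝[>] 0, 0 < t := self_mem_nhdsWithin
  filter_upwards [hpos.prod_mk hpos] with L ⟨h1, h2⟩
  have : L.1 + L.2 ≠ 0 := (add_pos h1 h2).ne'
  have h3 : L.2 - -L.1 ≠ 0 := by rwa [sub_neg_eq_add, add_comm]
  rw [finiteDipole_apply]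
  simp only [Function.comp, ContinuousLinearMap.toSpanSingleton_apply, smul_eq_mul]
  field_simp
  ring

/-! ### Assembly of the theorem -/

theorem existsUnique_leviCivita_dirac (b : ℝ) :
    (∀ ω' : Connection, IsLeviCivita (coframe b (Measure.dirac 0)) ω' ↔
      ω' = edgeConnection (b • Distribution.delta 0)) ∧
    ∀ Ω' : Curvature, IsCurvature (edgeConnection (b • Distribution.delta 0)) Ω' ↔
      Ω' = wedgeCurvature (dipole b) := by
  have hex := isLeviCivita_edgeConnection (b := b) isCompact_singleton dirac_compl_singleton
    (by simp) (by simp)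
  have hcurv := isCurvature_edgeConnection (b • Distribution.delta 0)
  rw [pderiv_smul] at hcurv
  rw [ofMeasure_dirac] at hex
  refine ⟨fun ω' => ⟨fun h => h.eq_edgeConnection, ?_⟩, fun Ω' => ⟨fun h => h.unique hcurv, ?_⟩⟩
  · rintro rfl
    exact hex
  · rintro rfl
    exact hcurv

end

end Volterra

open Volterra
theorem theorem3 (b : ℝ) :
    -- the plastic field of the single edge dislocation at the origin
    (∀ p : EuclideanSpace ℝ (Fin 3), (p 0 ≠ 0 ∨ p 1 ≠ 0) →
      biotSavart b (Measure.dirac 0) p =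
        ![-(b / (2 * Real.pi)) * (p 1 / (p 0 ^ 2 + p 1 ^ 2)),
          (b / (2 * Real.pi)) * (p 0 / (p 0 ^ 2 + p 1 ^ 2)), 0]) ∧
    (∀ k, LocallyIntegrable (plasticField b (Measure.dirac 0) k)) ∧
    -- with the Weitzenböck connection its coframe has torsion `τ² = b δ(x, y) dx ∧ dy`
    IsTorsion (coframe b (Measure.dirac 0)) 0 (edgeTorsion (b • Distribution.delta 0)) ∧
    IsCurvature 0 0 ∧
    -- the same coframe has exactly one Levi-Civita connection, with exactly one curvature,
    -- a point dipole of wedge disclinations with dipole moment `P = (b, 0)`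
    (∃ (ω : Connection) (Ω : Curvature) (P : Plane),
      (∀ ω' : Connection, IsLeviCivita (coframe b (Measure.dirac 0)) ω' ↔ ω' = ω) ∧
      (∀ Ω' : Curvature, IsCurvature ω Ω' ↔ Ω' = Ω) ∧
      Ω = wedgeCurvature
        (-(b • ∂_{(EuclideanSpace.single 0 1 : Plane)} (Distribution.delta 0 : Dist))) ∧
      (∀ φ : Test, (0 : Plane) ∉ tsupport φ → Ω 0 1 0 1 φ = 0) ∧
      HasPairing (Ω 0 1 0 1) (fun _ => 1) 0 ∧
      (∀ m : Fin 2, HasPairing (Ω 0 1 0 1) (fun x => x m) (P m)) ∧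
      P = !₂[b, 0] ∧
      inner ℝ P (!₂[0, b] : Plane) = 0) ∧
    -- wedge disclination dipoles with the same dipole moment: field and coframe
    (∀ Lm Lp : ℝ, 0 < Lm → 0 < Lp →
      (∀ k, LocallyIntegrable (plasticField b (arrayMeasure Lm Lp) k)) ∧
      IsTorsion (coframe b (arrayMeasure Lm Lp)) 0
        (edgeTorsion (b • ofMeasure (arrayMeasure Lm Lp))) ∧
      IsWedgeDipole (coframe b (arrayMeasure Lm Lp)) (b / (Lm + Lp)) !₂[Lp, 0] !₂[-Lm, 0] ∧
      (∀ m : Fin 2, HasPairing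
        ((b / (Lm + Lp)) • (Distribution.delta !₂[Lp, 0] - Distribution.delta !₂[-Lm, 0]))
        (fun x => x m) ((!₂[b, 0] : Plane) m))) ∧
    -- as the separation tends to zero, their plastic fields and their curvatures converge to
    -- those of the single edge dislocation
    (∀ p : EuclideanSpace ℝ (Fin 3), (p 0 ≠ 0 ∨ p 1 ≠ 0) →
      Tendsto (fun L : ℝ × ℝ => biotSavart b (arrayMeasure L.1 L.2) p)
        (𝓝[>] 0 ×ˢ 𝓝[>] 0) (𝓝 (biotSavart b (Measure.dirac 0) p))) ∧
    (∀ φ : Test,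
      Tendsto (fun L : ℝ × ℝ => ((b / (L.1 + L.2)) •
          (Distribution.delta !₂[L.2, 0] - Distribution.delta !₂[-L.1, 0] : Dist)) φ)
        (𝓝[>] 0 ×ˢ 𝓝[>] 0)
        (𝓝 ((-(b • ∂_{(EuclideanSpace.single 0 1 : Plane)}
          (Distribution.delta 0 : Dist))) φ))) := by
  have hd : volume ({0} : Set Plane) = 0 := by simp
  have hδ := ofMeasure_dirac (0 : Plane)
  refine ⟨fun p hp => ?_, fun k => locallyIntegrable_plasticField b isCompact_singleton
    dirac_compl_singleton hd k, ?_, isCurvature_zero, ?_, fun Lm Lp hm hp => ?_,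
    fun p hp => tendsto_biotSavart_arrayMeasure b hp, fun φ => tendsto_finiteDipole b φ⟩
  · rw [biotSavart_dirac b hp]
    funext k
    fin_cases k
    · simp [kernel_zero_apply, proj]
      ring
    · simp [kernel_one_apply, proj]
      ring
    · simp
  · rw [← hδ]
    exact isTorsion_zero isCompact_singleton dirac_compl_singleton hd
  · obtain ⟨h1, h2⟩ := existsUnique_leviCivita_dirac b
    refine ⟨_, _, !₂[b, 0], h1, h2, rfl, ?_⟩
    rw [wedgeCurvature_apply_eq]
    refine ⟨fun φ hφ => dipole_apply_of_notMem_tsupport b hφ, ?_, fun m => ?_, rfl, ?_⟩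
    · simpa using hasPairing_dipole b fun _ => 1
    · have h := hasPairing_dipole b fun x => x m
      rw [fderiv_coordinate] at h
      convert h using 1
      fin_cases m <;> simp
    · simp [PiLp.inner_apply]
  · have := isProbabilityMeasure_arrayMeasure hm hp
    refine ⟨locallyIntegrable_plasticField b (isCompact_segment Lm Lp)
      (arrayMeasure_compl_segment Lm Lp) (volume_segment Lm Lp),
      isTorsion_zero (isCompact_segment Lm Lp) (arrayMeasure_compl_segment Lm Lp)
      (volume_segment Lm Lp), isWedgeDipole_arrayMeasure b hm hp, fun m => ?_⟩
    have h := hasPairing_finiteDipole (b / (Lm + Lp)) !₂[Lp, 0] !₂[-Lm, 0] fun x => x m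
    convert h using 1
    fin_cases m
    · simp
      field_simp
      ring
    · simp
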